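/- An \emph{oblivious algebraic branching program} (ABP) of length $L$ over a field $\mathbb F$ in the variables $x_1,\dots,x_n$ is a layered directed graph with layers $0,1,\dots,L$, in which layer $0$ consists of one vertex (the source), layer $L$ consists of one vertex (the sink), edges go from layer $\ell-1$ to layer $\ell$, and for each $\ell$ all edges from layer $\ell-1$ to layer $\ell$ are labelled by univariate polynomials over $\mathbb F$ in one common variable $x_{i_\ell}$. It computes the sum, over all source-sink paths, of the product of the labels along the path. It has width $\le w$ if every layer has at most $w$ vertices, and degree $\le d$ if every label has degree at most $d$. It is a \emph{$k$-pass ABP} if there is a permutation $\pi$ of $\{1,\dots,n\}$ such that $L=kn$ and $(x_{i_1},\dots,x_{i_L})$ is the sequence $x_{\pi(1)},\dots,x_{\pi(n)}$ repeated $k$ times. Let $\mathcal C_{\mathbb F}(n,k,w,d)$ be the set of polynomials in $\mathbb F[x_1,\dots,x_n]$ computed by $k$-pass ABPs of width $\le w$ and degree $\le d$, where the order $\pi$ is arbitrary and not known. \textbf{Theorem.} There are an absolute constant $C$ and one deterministic black-box algorithm $P$ such that the following holds. Let $n\ge 2$ and $k,w,d\ge 1$, let $\mathbb F$ be any field, let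 $\mathbb K\supseteq\mathbb F$ be an extension field (possibly $\mathbb K=\mathbb F$), and let a list of at least $(nkd\,w^{2k})^{C}$ distinct elements of $\mathbb K$ be given. Then there is a finite set $\mathcal H\subseteq\mathbb K^n$ such that 1. $\mathcal H$ is a hitting set for $\mathcal C_{\mathbb F}(n,k,w,d)$: for every nonzero $f\in\mathcal C_{\mathbb F}(n,k,w,d)$ there is $a\in\mathcal H$ with $f(a)\ne 0$; 2. $|\mathcal H|\le (ndw)^{C k\lfloor\log_2 n\rfloor}$, and if $w\ge 2$ then also $|\mathcal H|\le (n w^{2k} d)^{C\lfloor\log_2 n\rfloor}$; 3. for every $f\in\mathcal C_{\mathbb F}(n,k,w,d)$, the algorithm $P$, given $n,k,w,d$, the list, and black-box access to the evaluation of $f$ at points of $\mathbb K^n$, decides correctly whether $f=0$. It queries $f$ exactly at the points of $\mathcal H$ (the same set for all $f$), and it halts after at most $(ndw)^{C k\lfloor\log_2 n\rfloor}$ steps, and if $w\ge 2$ after at most $(n w^{2k} d)^{C\lfloor\log_2 n\rfloor}$ steps. Here $P$ is a finite program, independent of the fields and of all parameters, for a random access machine with cells for natural numbers and cells for elements of $\mathbb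 K$; a step is one addition or truncated subtraction of natural numbers, one addition, subtraction or multiplication in $\mathbb K$, the loading of a constant, one (indirect) memory access, one access to the list, one test for zero, or one query. -/

import Mathlib

/-! ## Oblivious and k-pass algebraic branching programs -/

/-- An oblivious algebraic branching program over `F` in the variables `x_0, …, x_{n-1}`.
The vertices are split into the layers `0, …, length`; layer `l` consists of `size l` vertices,
and the first and the last layer have one vertex each, the source and the sink.
All edges from layer `l` to layer `l + 1` carry univariate polynomials in the single variable
`x_{var l}`; an absent edge is an edge with label `0`. -/
structure ObliviousABP (F : Type*) [Field F] (n : ℕ) where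
  length : ℕ
  size : Fin (length + 1) → ℕ
  size_source : size 0 = 1
  size_sink : size (Fin.last length) = 1
  var : Fin length → Fin n
  label : ∀ l : Fin length, Fin (size l.castSucc) → Fin (size l.succ) → Polynomial F

namespace ObliviousABP

variable {F : Type*} [Field F] {n : ℕ}

/-- A source-sink path: one vertex in every layer (the first and the last choice are forced). -/
abbrev Path (A : ObliviousABP F n) : Type :=
  ∀ l : Fin (A.length + 1), Fin (A.size l)

/-- The product of the edge labels along a path. -/
noncomputable def pathValue (A : ObliviousABP F n) (p : A.Path) : MvPolynomial (Fin n) F :=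
  ∏ l : Fin A.length,
    Polynomial.aeval (MvPolynomial.X (A.var l) : MvPolynomial (Fin n) F)
      (A.label l (p l.castSucc) (p l.succ))

/-- The polynomial computed by the program: the sum of the values of all source-sink paths. -/
noncomputable def computed (A : ObliviousABP F n) : MvPolynomial (Fin n) F :=
  ∑ p : A.Path, A.pathValue p

/-- Every layer has at most `w` vertices. -/
def WidthLE (A : ObliviousABP F n) (w : ℕ) : Prop :=
  ∀ l, A.size l ≤ w

/-- Every edge label has degree at most `d`. -/
def DegreeLE (A : ObliviousABP F n) (d : ℕ) : Prop :=
  ∀ l u v, (A.label l u v).natDegree ≤ d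

/-- For some permutation `π`, the program reads its variables in the order
`x_{π 0}, …, x_{π (n-1)}`, repeated `k` times. -/
def IsKPass (A : ObliviousABP F n) (k : ℕ) : Prop :=
  A.length = k * n ∧
    ∃ π : Equiv.Perm (Fin n), ∀ (l : Fin A.length) (i : Fin n),
      (l : ℕ) % n = (i : ℕ) → A.var l = π i

end ObliviousABP

/-- The `n`-variate polynomials over `F` computed by `k`-pass ABPs of width (at most) `w` and
degree (at most) `d`. -/
def kPassPolys (F : Type*) [Field F] (n k w d : ℕ) : Set (MvPolynomial (Fin n) F) :=
  {f | ∃ A : ObliviousABP F n, A.IsKPass k ∧ A.WidthLE w ∧ A.DegreeLE d ∧ A.computed = f}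

/-- `H` is a hitting set, with points over the extension field `K`, for a class `S` of
polynomials over `F`: every nonzero member of `S` is nonzero at some point of `H`. -/
def IsHittingSet {F K : Type*} [Field F] [Field K] [Algebra F K] {n : ℕ}
    (S : Set (MvPolynomial (Fin n) F)) (H : Finset (Fin n → K)) : Prop :=
  ∀ f ∈ S, f ≠ 0 → ∃ a ∈ H, MvPolynomial.aeval a f ≠ 0

/-! ## A random access machine over a field, with a black box

The machine has cells for natural numbers and cells for elements of the field. Its programs are
finite and do not mention the field. Natural numbers can only be added and subtracted, so that
unit cost is a fair measure. -/

namespace BlackBoxRAM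

/-- Basic instructions; their meaning is given by `Instr.apply`. -/
inductive Instr : Type
  | const (a c : ℕ)
  | add (a b c : ℕ)
  | sub (a b c : ℕ)
  | load (a b : ℕ)
  | store (a b : ℕ)
  | fzero (a : ℕ)
  | fone (a : ℕ)
  | fadd (a b c : ℕ)
  | fsub (a b c : ℕ)
  | fmul (a b c : ℕ)
  | fload (a b : ℕ)
  | fstore (a b : ℕ)
  | sample (a b : ℕ)
  | query (a b : ℕ)

/-- Programs: basic instructions, sequencing, tests of a cell for zero, and loops
(`loop a P` repeats `P` as long as the number in cell `a` is not zero). -/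
inductive Prog : Type
  | instr (i : Instr)
  | seq (P Q : Prog)
  | ifZero (a : ℕ) (P Q : Prog)
  | ifFieldZero (a : ℕ) (P Q : Prog)
  | loop (a : ℕ) (P : Prog)

/-- What the machine can access besides its memory: `sample`, a list of field elements, and the
black box `box`, a function of `n` field elements. -/
structure Env (K : Type*) (n : ℕ) where
  sample : ℕ → K
  box : (Fin n → K) → K

/-- A memory state. The component `asked` records the points at which the black box has been
queried; programs cannot read it. -/
structure State (K : Type*) (n : ℕ) where
  reg : ℕ → ℕ
  mem : ℕ → K
  asked : Set (Fin n → K)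

variable {K : Type*} [Field K] {n : ℕ}

/-- The effect of a basic instruction. -/
def Instr.apply (E : Env K n) (s : State K n) : Instr → State K n
  | .const a c => { s with reg := Function.update s.reg a c }
  | .add a b c => { s with reg := Function.update s.reg a (s.reg b + s.reg c) }
  | .sub a b c => { s with reg := Function.update s.reg a (s.reg b - s.reg c) }
  | .load a b => { s with reg := Function.update s.reg a (s.reg (s.reg b)) }
  | .store a b => { s with reg := Function.update s.reg (s.reg a) (s.reg b) }
  | .fzero a => { s with mem := Function.update s.mem a 0 }
  | .fone a => { s with mem := Function.update s.mem a 1 }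
  | .fadd a b c => { s with mem := Function.update s.mem a (s.mem b + s.mem c) }
  | .fsub a b c => { s with mem := Function.update s.mem a (s.mem b - s.mem c) }
  | .fmul a b c => { s with mem := Function.update s.mem a (s.mem b * s.mem c) }
  | .fload a b => { s with mem := Function.update s.mem a (s.mem (s.reg b)) }
  | .fstore a b => { s with mem := Function.update s.mem (s.reg a) (s.mem b) }
  | .sample a b => { s with mem := Function.update s.mem a (E.sample (s.reg b)) }
  | .query a b =>
      { s with
        mem := Function.update s.mem a (E.box fun i : Fin n => s.mem (s.reg b + (i : ℕ)))
        asked := insert (fun i : Fin n => s.mem (s.reg b + (i : ℕ))) s.asked }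

/-- `Exec E P s t s'`: started in state `s`, the program `P` halts in state `s'` after exactly
`t` steps. Every basic instruction and every test is one step. -/
inductive Exec (E : Env K n) : Prog → State K n → ℕ → State K n → Prop
  | instr (i : Instr) (s : State K n) : Exec E (.instr i) s 1 (i.apply E s)
  | seq {P Q : Prog} {s s' s'' : State K n} {t t' : ℕ} :
      Exec E P s t s' → Exec E Q s' t' s'' → Exec E (.seq P Q) s (t + t') s''
  | ifZero_true {a : ℕ} {P Q : Prog} {s s' : State K n} {t : ℕ} :
      s.reg a = 0 → Exec E P s t s' → Exec E (.ifZero a P Q) s (t + 1) s'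
  | ifZero_false {a : ℕ} {P Q : Prog} {s s' : State K n} {t : ℕ} :
      s.reg a ≠ 0 → Exec E Q s t s' → Exec E (.ifZero a P Q) s (t + 1) s'
  | ifFieldZero_true {a : ℕ} {P Q : Prog} {s s' : State K n} {t : ℕ} :
      s.mem a = 0 → Exec E P s t s' → Exec E (.ifFieldZero a P Q) s (t + 1) s'
  | ifFieldZero_false {a : ℕ} {P Q : Prog} {s s' : State K n} {t : ℕ} :
      s.mem a ≠ 0 → Exec E Q s t s' → Exec E (.ifFieldZero a P Q) s (t + 1) s'
  | loop_done {a : ℕ} {P : Prog} {s : State K n} :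
      s.reg a = 0 → Exec E (.loop a P) s 1 s
  | loop_step {a : ℕ} {P : Prog} {s s' s'' : State K n} {t t' : ℕ} :
      s.reg a ≠ 0 → Exec E P s t s' → Exec E (.loop a P) s' t' s'' →
        Exec E (.loop a P) s (t + t' + 1) s''

/-- The initial state on the input `(n, k, w, d)`: the four numbers in the cells `0, 1, 2, 3`,
zeros elsewhere, and no query made yet. -/
def init (K : Type*) [Field K] (n k w d : ℕ) : State K n where
  reg := fun a => if a = 0 then n else if a = 1 then k else if a = 2 then w
    else if a = 3 then d else 0
  mem := fun _ => 0
  asked := ∅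

/-- The environment given by a list `α` of `N` field elements (continued by zeros) and the black
box that evaluates the polynomial `f` at points over `K`. -/
noncomputable def polyEnv {F : Type*} [Field F] [Algebra F K] {N : ℕ} (α : Fin N → K)
    (f : MvPolynomial (Fin n) F) : Env K n where
  sample := fun i => if h : i < N then α ⟨i, h⟩ else 0
  box := fun a => MvPolynomial.aeval a f

end BlackBoxRAM

/-! ## Basis isolation -/

/-! Several passes reduce to one pass over a larger algebra. Let `M_q` be the product of the
transfer matrices of pass `q`. The computed polynomial is an entry of `M_1 ⋯ M_k`, and this entry
depends linearly on the Kronecker product of the `M_q`. Kronecker products are multiplicative, so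
all readings of one variable can be gathered into one factor: the polynomial is `ψ (∏ G_a)`, where
`ψ` is linear and `G_a` has degree at most `k d` in the variable read at position `a`, with
coefficients in a matrix algebra of dimension `r = w ^ (2 k)` (`exists_treeProd_of_mem_kPassPolys`).

Such products are handled by basis isolation. For a block of variables, a weight on exponents is
good if at most `r` coefficients, of distinct weights, span the others, each of which is a
combination of lighter ones among them. A functional that is not zero on all coefficients then has a
single nonzero value at the least weight where it has any (`Isolates.exists_unique_weight`). Two
blocks are merged by adding their weights and breaking ties among the at most `r ^ 2` products of
isolated coefficients only (`Isolates.exists_mul`). A tie-breaker giving `x_i` the weight `c ^ i mod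
p` exists, one `c` serving all blocks of a level, because a nonzero polynomial over `ZMod p` of
degree less than `p` has a nonroot (`exists_separating_base`). This weight refers to the names of
the variables and not to their positions, so the order need not be known.

A binary tree of blocks has about `log n` levels. Merging all tie-breakers into one number would
make it too large, so each level gets its own new variable: `x_i ↦ ∏ t_l ^ (c_l ^ i mod p)`. The
tuple of weights determines the merged weight, so some monomial in the `t_l` receives exactly one
nonzero term. The image is a nonzero polynomial of small degree in each `t_l`, hence nonzero
somewhere on a grid (`exists_aeval_ne_zero`).

The hitting set takes all choices of `c_l`, modulus and `t_l`, encoded as three digits per level of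
one number (`digitPoint`). The machine runs through these numbers; any time polynomial in their
count `Z` is affordable, so arithmetic by repeated addition suffices (`identityTest_ends`). -/

namespace BasisIsolation

open Finset Submodule

/-! ### Greedy bases with respect to a weight. -/

section Greedy

variable {F V X : Type*} [Field F] [AddCommGroup V] [Module F V]

/-- The elements of `S` of weight less than `m`. -/
def below (S : Finset X) (wt : X → ℕ) (m : ℕ) : Set X := {s | s ∈ S ∧ wt s < m}

/-- `S` is a set of at most `r` indices with distinct weights, and every other vector of the family
`c` is a combination of the vectors from `S` of smaller weight. -/
structure Isolates (F : Type*) {V X : Type*} [Field F] [AddCommGroup V] [Module F V]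
    (r : ℕ) (c : X → V) (wt : X → ℕ) (S : Finset X) : Prop where
  card_le : S.card ≤ r
  injOn : Set.InjOn wt S
  mem_span : ∀ x, x ∉ S → c x ∈ span F (c '' below S wt (wt x))

lemma below_mono (S : Finset X) (wt : X → ℕ) {m m' : ℕ} (h : m ≤ m') :
    below S wt m ⊆ below S wt m' :=
  fun _ hs => ⟨hs.1, hs.2.trans_le h⟩

lemma Isolates.mem_span_succ {r : ℕ} {c : X → V} {wt : X → ℕ} {S : Finset X}
    (h : Isolates F r c wt S) (x : X) : c x ∈ span F (c '' below S wt (wt x + 1)) := by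
  by_cases hx : x ∈ S
  · exact subset_span ⟨x, ⟨hx, Nat.lt_succ_self _⟩, rfl⟩
  · exact span_mono (Set.image_mono (below_mono S wt (Nat.le_succ _))) (h.mem_span x hx)

/-- Insert the elements in order of weight. As weights are distinct, all earlier elements are
strictly lighter, so the new vector lies outside their span. -/
lemma linearIndepOn_of_notMem_span_below (c : X → V) (wt : X → ℕ) (S : Finset X)
    (hinj : Set.InjOn wt S) (hS : ∀ x ∈ S, c x ∉ span F (c '' below S wt (wt x))) :
    LinearIndepOn F c (S : Set X) := by
  classical
  induction S using Finset.induction_on_max_value wt with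
  | empty => simp
  | insert a s ha hmax ih =>
    rw [coe_insert, linearIndepOn_insert (by simpa using ha)]
    refine ⟨ih (hinj.mono (by simp)) fun x hx hmem => ?_, fun hmem => ?_⟩
    · refine hS x (mem_insert_of_mem hx) (span_mono (Set.image_mono ?_) hmem)
      exact fun y hy => ⟨mem_insert_of_mem hy.1, hy.2⟩
    · refine hS a (mem_insert_self _ _) (span_mono (Set.image_mono ?_) hmem)
      intro y hy
      refine ⟨mem_insert_of_mem hy, lt_of_le_of_ne (hmax y hy) fun he => ha ?_⟩
      have := hinj (mem_coe.2 (mem_insert_of_mem hy)) (mem_coe.2 (mem_insert_self a s)) he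
      exact this ▸ hy

/-- The matroid greedy algorithm: keep a member of `A` if it is not spanned by lighter members.
Working inside `A` matters for merging, where the weight is injective only on a small set. -/
lemma exists_greedy [FiniteDimensional F V] (c : X → V) (wt : X → ℕ) (A : Finset X)
    (hinj : Set.InjOn wt A) :
    ∃ S ⊆ A, S.card ≤ Module.finrank F V ∧
      ∀ x ∈ A, c x ∈ span F (c '' below S wt (wt x + 1)) ∧
        (x ∉ S → c x ∈ span F (c '' below S wt (wt x))) := by
  classical
  set S := A.filter fun x => c x ∉ span F (c '' below A wt (wt x)) with hSdef
  have hsub : S ⊆ A := filter_subset _ _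
  -- By induction on the weight, lighter members of `A` may be replaced by lighter members of `S`
  -- without shrinking the span.
  have key : ∀ m, ∀ x ∈ A, wt x < m → c x ∈ span F (c '' below S wt (wt x + 1)) ∧
        (x ∉ S → c x ∈ span F (c '' below S wt (wt x))) := by
    intro m
    induction m with
    | zero => intro x _ h; omega
    | succ m ih =>
      intro x hx hm
      have h2 : x ∉ S → c x ∈ span F (c '' below S wt (wt x)) := by
        intro hxS
        have hmem : c x ∈ span F (c '' below A wt (wt x)) := by
          by_contra hcon
          exact hxS (mem_filter.2 ⟨hx, hcon⟩)
        refine (span_le.2 ?_) hmem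
        rintro _ ⟨y, ⟨hyA, hy⟩, rfl⟩
        exact span_mono (Set.image_mono (below_mono S wt hy)) (ih y hyA (by omega)).1
      refine ⟨?_, h2⟩
      by_cases hxS : x ∈ S
      · exact subset_span ⟨x, ⟨hxS, Nat.lt_succ_self _⟩, rfl⟩
      · exact span_mono (Set.image_mono (below_mono S wt (Nat.le_succ _))) (h2 hxS)
  refine ⟨S, hsub, ?_, fun x hx => key _ x hx (Nat.lt_succ_self _)⟩
  have hli : LinearIndepOn F c (S : Set X) := by
    refine linearIndepOn_of_notMem_span_below c wt S (hinj.mono hsub) fun x hx hmem => ?_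
    refine (mem_filter.1 hx).2 (span_mono (Set.image_mono ?_) hmem)
    exact fun y hy => ⟨hsub hy.1, hy.2⟩
  have := LinearIndependent.fintype_card_le_finrank hli
  simpa using this

lemma exists_isolates [FiniteDimensional F V] [Fintype X] (c : X → V) (wt : X → ℕ)
    (hinj : Function.Injective wt) : ∃ S, Isolates F (Module.finrank F V) c wt S := by
  obtain ⟨S, -, hcard, hS⟩ := exists_greedy (F := F) c wt Finset.univ hinj.injOn
  exact ⟨S, hcard, hinj.injOn, fun x hx => (hS x (mem_univ x)).2 hx⟩

/-- A functional that does not vanish on the family is nonzero at a unique index among those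
of some weight. -/
lemma Isolates.exists_unique_weight {r : ℕ} {c : X → V} {wt : X → ℕ} {S : Finset X}
    (h : Isolates F r c wt S) (ψ : V →ₗ[F] F) (hψ : ∃ x, ψ (c x) ≠ 0) :
    ∃ x, ψ (c x) ≠ 0 ∧ ∀ y, ψ (c y) ≠ 0 → wt y = wt x → y = x := by
  classical
  have hex : ∃ m, ∃ x, ψ (c x) ≠ 0 ∧ wt x = m := by
    obtain ⟨x, hx⟩ := hψ
    exact ⟨_, x, hx, rfl⟩
  obtain ⟨x, hx, hxm⟩ := Nat.find_spec hex
  -- At the least weight where `ψ` is nonzero, an index outside `S` would be a combination of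
  -- lighter vectors, all killed by `ψ`.
  have hmem : ∀ y, ψ (c y) ≠ 0 → wt y = wt x → y ∈ S := by
    intro y hy hyx
    by_contra hyS
    refine hy ?_
    have hle : span F (c '' below S wt (wt y)) ≤ LinearMap.ker ψ := by
      refine span_le.2 ?_
      rintro _ ⟨s, ⟨_, hs⟩, rfl⟩
      by_contra hne
      exact Nat.find_min hex (by omega) ⟨s, hne, rfl⟩
    exact hle (h.mem_span y hyS)
  exact ⟨x, hx, fun y hy hyx => h.injOn (hmem y hy hyx) (hmem x hx rfl) hyx⟩

end Greedy

/-! ### Merging the isolated bases of two blocks. -/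

section Merge

open scoped Pointwise

variable {F A X Y : Type*} [Field F] [Ring A] [Algebra F A] [FiniteDimensional F A]

/-- The sum `α + β` dominates and `γ` breaks ties. If one index is not isolated, the product is a
combination of products over `S ×ˢ T` with strictly smaller `α + β`, whatever `γ` does. Hence `γ`
need only be injective on `S ×ˢ T`. -/
lemma Isolates.exists_mul {r r' : ℕ} {c : X → A} {c' : Y → A} {α : X → ℕ} {β : Y → ℕ}
    {S : Finset X} {T : Finset Y} (hS : Isolates F r c α S) (hT : Isolates F r' c' β T)
    (γ : X × Y → ℕ) (hγ : Set.InjOn γ (S ×ˢ T : Finset (X × Y))) (Q : ℕ)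
    (hQ : ∀ z, γ z < Q) :
    ∃ R, Isolates F (Module.finrank F A) (fun z : X × Y => c z.1 * c' z.2)
      (fun z => Q * (α z.1 + β z.2) + γ z) R := by
  classical
  set wt : X × Y → ℕ := fun z => Q * (α z.1 + β z.2) + γ z with hwt
  set e : X × Y → A := fun z => c z.1 * c' z.2 with he
  have hinj : Set.InjOn wt (S ×ˢ T : Finset (X × Y)) := by
    intro z hz z' hz' h
    refine hγ hz hz' ?_
    have := congrArg (· % Q) h
    simpa [hwt, Nat.mul_add_mod, Nat.mod_eq_of_lt (hQ _)] using this
  obtain ⟨R, hRsub, hRcard, hR⟩ := exists_greedy (F := F) e wt (S ×ˢ T) hinj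
  refine ⟨R, hRcard, hinj.mono hRsub, ?_⟩
  rintro ⟨x, y⟩ hxy
  by_cases hmem : (x, y) ∈ S ×ˢ T
  · exact (hR _ hmem).2 hxy
  -- The bounds `m`, `m'` are exclusive. One factor is expanded strictly and the other with bound
  -- one higher, which gives the `+ 1` and still forces `α s + β t < α x + β y`.
  have main : ∀ m m', c x ∈ span F (c '' below S α m) → c' y ∈ span F (c' '' below T β m') →
      m + m' ≤ α x + β y + 1 → e (x, y) ∈ span F (e '' below R wt (wt (x, y))) := by
    intro m m' hx hy hm
    have hprod : e (x, y) ∈ span F ((c '' below S α m) * (c' '' below T β m')) := by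
      rw [← span_mul_span]
      exact mul_mem_mul hx hy
    refine (span_le.2 ?_) hprod
    rintro _ ⟨_, ⟨s, ⟨hs, hsm⟩, rfl⟩, _, ⟨t, ⟨ht, htm⟩, rfl⟩, rfl⟩
    refine span_mono (Set.image_mono (below_mono R wt ?_)) (hR (s, t) (mem_product.2 ⟨hs, ht⟩)).1
    have h1 : α s + β t + 1 ≤ α x + β y := by omega
    have h2 : Q * (α s + β t + 1) ≤ Q * (α x + β y) := Nat.mul_le_mul_left _ h1
    have h3 := hQ (s, t)
    simp only [hwt]
    rw [mul_add, mul_one] at h2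
    omega
  by_cases hx : x ∈ S
  · have hy : y ∉ T := fun hy => hmem (mem_product.2 ⟨hx, hy⟩)
    exact main _ _ (hS.mem_span_succ x) (hT.mem_span y hy) (by omega)
  · exact main _ _ (hS.mem_span x hx) (hT.mem_span_succ y) (by omega)

end Merge

/-! ### Separating exponent vectors by powers modulo a prime. -/

section Separation

open Polynomial

/-- If the two weights of a pair agree, then `c` is a root modulo `p` of `∑ (q.1 i - q.2 i) X ^ σ
i`. This is nonzero, as the exponents are less than `p` and `σ` is injective. The product over all
pairs has degree at most `Q.card * m < p`, so some residue is no root. -/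
lemma exists_separating_base {p : ℕ} [Fact p.Prime] {m D : ℕ} (hD : D < p) (σ : ℕ → ℕ)
    (hσ : Set.InjOn σ (Set.Iio m)) (hσm : ∀ i < m, σ i < m) (Q : Finset ((ℕ →₀ ℕ) × (ℕ →₀ ℕ)))
    (hne : ∀ q ∈ Q, q.1 ≠ q.2)
    (hle : ∀ q ∈ Q, ∀ i, q.1 i ≤ D ∧ q.2 i ≤ D)
    (hsupp : ∀ q ∈ Q, q.1.support ⊆ range m ∧ q.2.support ⊆ range m)
    (hcard : Q.card * m < p) :
    ∃ c < p, ∀ q ∈ Q, Finsupp.weight (fun i => c ^ σ i % p) q.1 ≠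
      Finsupp.weight (fun i => c ^ σ i % p) q.2 := by
  classical
  let f : (ℕ →₀ ℕ) × (ℕ →₀ ℕ) → (ZMod p)[X] := fun q =>
    ∑ i ∈ range m, C ((q.1 i : ZMod p) - q.2 i) * X ^ σ i
  have hcoeff : ∀ q, ∀ i < m, (f q).coeff (σ i) = (q.1 i : ZMod p) - q.2 i := by
    intro q i hi
    simp only [f, finsetSum_coeff, coeff_C_mul, coeff_X_pow]
    rw [Finset.sum_eq_single i]
    · simp
    · intro j hj hji
      rw [if_neg, mul_zero]
      exact fun h => hji (hσ (by simpa using hj) hi h.symm)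
    · intro h; exact absurd (mem_range.2 hi) h
  have hne0 : ∀ q ∈ Q, f q ≠ 0 := by
    intro q hq h0
    refine hne q hq (Finsupp.ext fun i => ?_)
    by_cases hi : i < m
    · have h := hcoeff q i hi
      rw [h0, coeff_zero, eq_comm, sub_eq_zero, ZMod.natCast_eq_natCast_iff',
        Nat.mod_eq_of_lt ((hle q hq i).1.trans_lt hD),
        Nat.mod_eq_of_lt ((hle q hq i).2.trans_lt hD)] at h
      exact h
    · have h1 : i ∉ q.1.support := fun h => hi (mem_range.1 ((hsupp q hq).1 h))
      have h2 : i ∉ q.2.support := fun h => hi (mem_range.1 ((hsupp q hq).2 h))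
      rw [Finsupp.notMem_support_iff.1 h1, Finsupp.notMem_support_iff.1 h2]
  have hdeg : ∀ q, (f q).natDegree ≤ m := fun q => by
    refine natDegree_sum_le_of_forall_le _ _ fun i hi => ?_
    exact (natDegree_C_mul_X_pow_le _ _).trans (hσm i (mem_range.1 hi)).le
  have hprod : (∏ q ∈ Q, f q) ≠ 0 := Finset.prod_ne_zero_iff.2 hne0
  have hlt : ((∏ q ∈ Q, f q).natDegree : Cardinal) < Cardinal.mk (ZMod p) := by
    rw [Cardinal.mk_fintype, ZMod.card]
    refine Nat.cast_lt.2 (lt_of_le_of_lt ((natDegree_prod_le _ _).trans ?_) hcard)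
    exact (Finset.sum_le_card_nsmul _ _ m fun q _ => hdeg q).trans (by simp)
  obtain ⟨z, hz⟩ := exists_eval_ne_zero_of_natDegree_lt_card _ hprod hlt
  refine ⟨z.val, ZMod.val_lt z, fun q hq h => ?_⟩
  rw [eval_prod, Finset.prod_ne_zero_iff] at hz
  refine hz q hq ?_
  have hw : ∀ e : ℕ →₀ ℕ, e.support ⊆ range m →
      ((Finsupp.weight (fun i => z.val ^ σ i % p) e : ℕ) : ZMod p) =
        ∑ i ∈ range m, (e i : ZMod p) * z ^ σ i := by
    intro e he
    rw [Finsupp.weight_apply, Finsupp.sum_of_support_subset e he _ (by simp)]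
    simp [ZMod.natCast_mod]
  have h' := congrArg (Nat.cast : ℕ → ZMod p) h
  rw [hw _ (hsupp q hq).1, hw _ (hsupp q hq).2] at h'
  simp only [f, eval_finsetSum, eval_mul, eval_C, eval_pow, eval_X, sub_mul,
    Finset.sum_sub_distrib, h', sub_self]

end Separation

end BasisIsolation

namespace BasisIsolation

open Finset Submodule

/-! ### Products along a binary tree -/

/-- Indices of the summands of a product of `2 ^ j` polynomials of degree at most `D`. -/
def TreeIdx (D : ℕ) : ℕ → Type
  | 0 => Fin (D + 1)
  | j + 1 => TreeIdx D j × TreeIdx D j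

instance TreeIdx.fintype (D : ℕ) : ∀ j, Fintype (TreeIdx D j)
  | 0 => inferInstanceAs (Fintype (Fin (D + 1)))
  | j + 1 =>
    haveI := TreeIdx.fintype D j
    inferInstanceAs (Fintype (TreeIdx D j × TreeIdx D j))

/-- The product of the entries selected by `x`, over the `a`-th block of length `2 ^ j`. -/
def treeProd {A : Type*} [Mul A] {D : ℕ} (g : ℕ → Fin (D + 1) → A) :
    ∀ j, ℕ → TreeIdx D j → A
  | 0, a, x => g a x
  | j + 1, a, x => treeProd g j (2 * a) x.1 * treeProd g j (2 * a + 1) x.2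

/-- The exponents selected by `x`, over the `a`-th block of length `2 ^ j`. -/
noncomputable def treeExp {D : ℕ} : ∀ j, ℕ → TreeIdx D j → (ℕ →₀ ℕ)
  | 0, a, x => Finsupp.single a (Fin.val (n := D + 1) x)
  | j + 1, a, x => treeExp j (2 * a) x.1 + treeExp j (2 * a + 1) x.2

lemma treeExp_apply_eq_zero {D : ℕ} (j a : ℕ) (x : TreeIdx D j) (i : ℕ)
    (hi : i < a * 2 ^ j ∨ (a + 1) * 2 ^ j ≤ i) : treeExp j a x i = 0 := by
  induction j generalizing a with
  | zero =>
    simp only [treeExp, pow_zero, mul_one] at hi ⊢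
    exact Finsupp.single_eq_of_ne (by omega)
  | succ j ih =>
    have h1 : a * 2 ^ (j + 1) = 2 * a * 2 ^ j := by ring
    have h2 : (a + 1) * 2 ^ (j + 1) = (2 * a + 1 + 1) * 2 ^ j := by ring
    rw [h1, h2] at hi
    have h3 : 2 * a * 2 ^ j ≤ (2 * a + 1) * 2 ^ j := Nat.mul_le_mul_right _ (by omega)
    have h4 : (2 * a + 1) * 2 ^ j ≤ (2 * a + 1 + 1) * 2 ^ j := Nat.mul_le_mul_right _ (by omega)
    simp only [treeExp, Finsupp.add_apply]
    rw [ih _ _ (by omega), ih _ _ (by omega)]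

lemma treeExp_apply_le {D : ℕ} (j a : ℕ) (x : TreeIdx D j) (i : ℕ) : treeExp j a x i ≤ D := by
  induction j generalizing a with
  | zero =>
    simp only [treeExp, Finsupp.single_apply]
    split_ifs
    · exact Nat.lt_succ_iff.1 (Fin.is_lt (n := D + 1) x)
    · exact Nat.zero_le _
  | succ j ih =>
    simp only [treeExp, Finsupp.add_apply]
    rcases lt_or_ge i ((2 * a + 1) * 2 ^ j) with h | h
    · rw [treeExp_apply_eq_zero j (2 * a + 1) _ i (Or.inl h), add_zero]
      exact ih _ _
    · rw [treeExp_apply_eq_zero j (2 * a) _ i (Or.inr h), zero_add]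
      exact ih _ _

/-- Sibling blocks occupy disjoint ranges of positions, so both summands can be recovered from the
sum. -/
lemma treeExp_injective {D : ℕ} (j a : ℕ) : Function.Injective (treeExp (D := D) j a) := by
  induction j generalizing a with
  | zero =>
    intro x y h
    exact Fin.val_injective (n := D + 1) (Finsupp.single_injective a h)
  | succ j ih =>
    rintro ⟨x, y⟩ ⟨x', y'⟩ h
    have happ : ∀ i, treeExp j (2 * a) x i + treeExp j (2 * a + 1) y i =
        treeExp j (2 * a) x' i + treeExp j (2 * a + 1) y' i := fun i => DFunLike.congr_fun h i
    have hx : treeExp j (2 * a) x = treeExp j (2 * a) x' := by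
      ext i
      rcases lt_or_ge i ((2 * a + 1) * 2 ^ j) with hi | hi
      · have := happ i
        rwa [treeExp_apply_eq_zero j (2 * a + 1) y i (Or.inl hi),
          treeExp_apply_eq_zero j (2 * a + 1) y' i (Or.inl hi), add_zero, add_zero] at this
      · rw [treeExp_apply_eq_zero j (2 * a) x i (Or.inr hi),
          treeExp_apply_eq_zero j (2 * a) x' i (Or.inr hi)]
    have hy : treeExp j (2 * a + 1) y = treeExp j (2 * a + 1) y' := by
      have h' : treeExp j (2 * a) x + treeExp j (2 * a + 1) y =
        treeExp j (2 * a) x' + treeExp j (2 * a + 1) y' := h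
      rwa [hx, add_right_inj] at h'
    exact Prod.ext (ih _ hx) (ih _ hy)

lemma treeExp_support_subset {D : ℕ} {L j a : ℕ} (hj : j ≤ L) (ha : a < 2 ^ (L - j))
    (x : TreeIdx D j) : (treeExp j a x).support ⊆ range (2 ^ L) := by
  intro i hi
  rw [mem_range]
  by_contra hcon
  refine Finsupp.mem_support_iff.1 hi (treeExp_apply_eq_zero j a x i (Or.inr ?_))
  calc (a + 1) * 2 ^ j ≤ 2 ^ (L - j) * 2 ^ j := Nat.mul_le_mul_right _ ha
    _ = 2 ^ L := by rw [← pow_add, Nat.sub_add_cancel hj]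
    _ ≤ i := by omega

/-! ### Isolating weights for products -/

variable {F A : Type*} [Field F] [Ring A] [Algebra F A] [FiniteDimensional F A]

/-- The weight of an exponent vector in which position `i` has weight `c ^ σ i mod p`. -/
noncomputable def powWeight (p : ℕ) (σ : ℕ → ℕ) (c : ℕ) (e : ℕ →₀ ℕ) : ℕ :=
  Finsupp.weight (fun i => c ^ σ i % p) e

lemma powWeight_add (p : ℕ) (σ : ℕ → ℕ) (c : ℕ) (e e' : ℕ →₀ ℕ) :
    powWeight p σ c (e + e') = powWeight p σ c e + powWeight p σ c e' :=
  map_add _ _ _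

/-- One basis for every block of length `2 ^ j`, with respect to weights that are determined by
the weights `powWeight p σ (c l)` for `l ≤ j`. -/
theorem exists_isolates_treeProd {D : ℕ} (g : ℕ → Fin (D + 1) → A) {p : ℕ} [hp : Fact p.Prime]
    (hD : D < p) (L : ℕ) (σ : ℕ → ℕ) (hσ : Set.InjOn σ (Set.Iio (2 ^ L)))
    (hσm : ∀ i < 2 ^ L, σ i < 2 ^ L)
    (hlarge : 2 ^ L * Module.finrank F A ^ 4 * 2 ^ L < p) (j : ℕ) (hj : j ≤ L) :
    ∃ (c : ℕ → ℕ) (v : (ℕ →₀ ℕ) → ℕ), (∀ l, c l < p) ∧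
      (∀ e e', (∀ l ≤ j, powWeight p σ (c l) e = powWeight p σ (c l) e') → v e = v e') ∧
      (∀ e e', v (e + e') = v e + v e') ∧
      ∀ a < 2 ^ (L - j), ∃ S, Isolates F (Module.finrank F A) (treeProd g j a)
        (fun x => v (treeExp j a x)) S := by
  classical
  induction j with
  | zero =>
    -- At a leaf the base `1` gives the position weight `1`, so the weight is the exponent itself.
    refine ⟨fun _ => 1, powWeight p σ 1, fun _ => hp.out.one_lt, fun e e' h => h 0 le_rfl,
      powWeight_add p σ 1, fun a _ => exists_isolates _ _ fun x y h => ?_⟩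
    simp only [powWeight, treeExp, Finsupp.weight_single, one_pow, smul_eq_mul,
      Nat.mod_eq_of_lt hp.out.one_lt, mul_one] at h
    exact Fin.val_injective (n := D + 1) h
  | succ j ih =>
    obtain ⟨c, v, hc, hdet, hadd, hiso⟩ := ih (by omega)
    have h2 : 2 * 2 ^ (L - (j + 1)) = 2 ^ (L - j) := by
      rw [← pow_succ', show L - (j + 1) + 1 = L - j by omega]
    choose! S hS using hiso
    -- All ties to be broken on this level, over all blocks together, so that one base works for
    -- every block; a block contributes fewer than `r ^ 4` pairs unless `r = 0`.
    let Q : Finset ((ℕ →₀ ℕ) × (ℕ →₀ ℕ)) := (range (2 ^ (L - (j + 1)))).biUnion fun a =>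
      ((S (2 * a) ×ˢ S (2 * a + 1)).offDiag).image fun z =>
        (treeExp (D := D) (j + 1) a z.1, treeExp (D := D) (j + 1) a z.2)
    have hQmem : ∀ q, q ∈ Q ↔ ∃ a < 2 ^ (L - (j + 1)), ∃ z z' : TreeIdx D (j + 1),
        z ∈ S (2 * a) ×ˢ S (2 * a + 1) ∧ z' ∈ S (2 * a) ×ˢ S (2 * a + 1) ∧ z ≠ z' ∧
        (treeExp (j + 1) a z, treeExp (j + 1) a z') = q := by
      intro q
      simp only [Q, mem_biUnion, mem_range, mem_image, mem_offDiag]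
      constructor
      · rintro ⟨a, ha, ⟨z, z'⟩, ⟨h1, h2, h3⟩, h4⟩
        exact ⟨a, ha, z, z', h1, h2, h3, h4⟩
      · rintro ⟨a, ha, z, z', h1, h2, h3, h4⟩
        exact ⟨a, ha, (z, z'), ⟨h1, h2, h3⟩, h4⟩
    have hQcard : Q.card * 2 ^ L < p := by
      refine lt_of_le_of_lt (Nat.mul_le_mul_right _ ?_) hlarge
      refine (card_biUnion_le_card_mul _ _ (Module.finrank F A ^ 4) fun a ha => ?_).trans ?_
      · rw [mem_range] at ha
        refine card_image_le.trans ?_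
        rw [offDiag_card]
        refine (Nat.sub_le _ _).trans ?_
        have h3 := (hS (2 * a) (by omega)).card_le
        have h4 := (hS (2 * a + 1) (by omega)).card_le
        rw [card_product]
        calc _ ≤ (Module.finrank F A * Module.finrank F A) *
              (Module.finrank F A * Module.finrank F A) := by gcongr
          _ = _ := by ring
      · rw [card_range]
        exact Nat.mul_le_mul_right _ (Nat.pow_le_pow_right (by norm_num) (Nat.sub_le _ _))
    obtain ⟨b, hb, hsep⟩ := exists_separating_base (p := p) hD σ hσ hσm Q
      (by
        intro q hq
        obtain ⟨a, -, z, z', -, -, hne, rfl⟩ := (hQmem q).1 hq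
        exact fun h => hne (treeExp_injective (j + 1) a h))
      (by
        intro q hq i
        obtain ⟨a, -, z, z', -, -, hne, rfl⟩ := (hQmem q).1 hq
        exact ⟨treeExp_apply_le _ _ _ _, treeExp_apply_le _ _ _ _⟩)
      (by
        intro q hq
        obtain ⟨a, ha, z, z', -, -, hne, rfl⟩ := (hQmem q).1 hq
        exact ⟨treeExp_support_subset hj ha _, treeExp_support_subset hj ha _⟩)
      hQcard
    -- The size of `N` is irrelevant: `v` serves only to prove isolation, while the substitution
    -- uses the separate weights that determine it.
    let N : ℕ := 1 + ∑ a ∈ range (2 ^ (L - (j + 1))), ∑ z : TreeIdx D (j + 1),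
      powWeight p σ b (treeExp (j + 1) a z)
    have hN : ∀ a < 2 ^ (L - (j + 1)), ∀ z : TreeIdx D (j + 1),
        powWeight p σ b (treeExp (j + 1) a z) < N := by
      intro a ha z
      have h3 := single_le_sum (f := fun z : TreeIdx D (j + 1) =>
        powWeight p σ b (treeExp (j + 1) a z)) (fun _ _ => Nat.zero_le _) (mem_univ z)
      have h4 := single_le_sum (f := fun a => ∑ z : TreeIdx D (j + 1),
        powWeight p σ b (treeExp (j + 1) a z)) (fun _ _ => Nat.zero_le _) (mem_range.2 ha)
      simp only [N] at *
      omega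
    refine ⟨Function.update c (j + 1) b, fun e => N * v e + powWeight p σ b e, ?_, ?_, ?_, ?_⟩
    · intro l
      rcases eq_or_ne l (j + 1) with rfl | hl
      · simpa using hb
      · rw [Function.update_of_ne hl]; exact hc l
    · intro e e' h
      have h3 := h (j + 1) le_rfl
      rw [Function.update_self] at h3
      have h4 : v e = v e' := hdet e e' fun l hl => by
        have := h l (by omega)
        rwa [Function.update_of_ne (by omega)] at this
      simp only [h3, h4]
    · intro e e'
      simp only [hadd, powWeight_add]
      ring
    · intro a ha
      have := (hS (2 * a) (by omega)).exists_mul (hS (2 * a + 1) (by omega))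
        (fun z : TreeIdx D j × TreeIdx D j => powWeight p σ b (treeExp (D := D) (j + 1) a z)) (by
          intro z hz z' hz' h
          by_contra hne
          exact hsep _ ((hQmem _).2 ⟨a, ha, z, z', hz, hz', hne, rfl⟩) h) N (hN a ha)
      obtain ⟨R, hR⟩ := this
      refine ⟨R, ?_⟩
      have heq : (fun x : TreeIdx D (j + 1) => N * v (treeExp (j + 1) a x) +
          powWeight p σ b (treeExp (j + 1) a x)) = fun z : TreeIdx D j × TreeIdx D j =>
          N * (v (treeExp j (2 * a) z.1) + v (treeExp j (2 * a + 1) z.2)) +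
            powWeight p σ b (treeExp (D := D) (j + 1) a z) := by
        funext z
        simp only [treeExp, hadd]
      rw [heq]
      exact hR

/-- The powers `c l` isolate one term of a nonzero combination. -/
theorem exists_isolated_term {D : ℕ} (g : ℕ → Fin (D + 1) → A) {p : ℕ} [hp : Fact p.Prime]
    (hD : D < p) (L : ℕ) (σ : ℕ → ℕ) (hσ : Set.InjOn σ (Set.Iio (2 ^ L)))
    (hσm : ∀ i < 2 ^ L, σ i < 2 ^ L)
    (hlarge : 2 ^ L * Module.finrank F A ^ 4 * 2 ^ L < p) (ψ : A →ₗ[F] F)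
    (hψ : ∃ x, ψ (treeProd g L 0 x) ≠ 0) :
    ∃ c : ℕ → ℕ, (∀ l, c l < p) ∧ ∃ x, ψ (treeProd g L 0 x) ≠ 0 ∧
      ∀ y, ψ (treeProd g L 0 y) ≠ 0 →
        (∀ l ≤ L, powWeight p σ (c l) (treeExp L 0 y) = powWeight p σ (c l) (treeExp L 0 x)) →
        y = x := by
  obtain ⟨c, v, hc, hdet, -, hiso⟩ :=
    exists_isolates_treeProd (F := F) g hD L σ hσ hσm hlarge L le_rfl
  obtain ⟨S, hS⟩ := hiso 0 (by simp)
  obtain ⟨x, hx, huniq⟩ := hS.exists_unique_weight ψ hψ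
  exact ⟨c, hc, x, hx, fun y hy h => huniq y hy (hdet _ _ h)⟩

end BasisIsolation

namespace BasisIsolation

open Finset

/-! ### Substituting products of powers -/

lemma powWeight_le {p : ℕ} (hp : 0 < p) (σ : ℕ → ℕ) (c m D : ℕ) (e : ℕ →₀ ℕ)
    (he : e.support ⊆ range m) (hD : ∀ i, e i ≤ D) : powWeight p σ c e ≤ m * (D * p) := by
  rw [powWeight, Finsupp.weight_apply, Finsupp.sum_of_support_subset e he _ (by simp)]
  refine (sum_le_card_nsmul _ _ (D * p) fun i _ => ?_).trans (by simp)
  exact Nat.mul_le_mul (hD i) (Nat.mod_lt _ hp).le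

/-- A nonzero polynomial that is read off a product along a tree does not vanish at some point
whose coordinates are products of powers of elements of a large set. -/
theorem exists_aeval_ne_zero {F K A : Type*} [Field F] [Field K] [Algebra F K] [Ring A]
    [Algebra F A] [FiniteDimensional F A] {n D : ℕ} (g : ℕ → Fin (D + 1) → A) {p : ℕ}
    [hp : Fact p.Prime] (hD : D < p) (L : ℕ) (σ : ℕ → ℕ) (hσ : Set.InjOn σ (Set.Iio (2 ^ L)))
    (hσm : ∀ i < 2 ^ L, σ i < 2 ^ L)
    (hlarge : 2 ^ L * Module.finrank F A ^ 4 * 2 ^ L < p) (ψ : A →ₗ[F] F)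
    (f : MvPolynomial (Fin n) F)
    (hf : MvPolynomial.rename Fin.val f = ∑ x : TreeIdx D L,
      MvPolynomial.C (ψ (treeProd g L 0 x)) *
        (treeExp L 0 x).prod fun a m => (MvPolynomial.X (σ a) : MvPolynomial ℕ F) ^ m)
    (hf0 : f ≠ 0) (T : Finset K) (hT : 2 ^ L * (D * p) < T.card) :
    ∃ (c : ℕ → ℕ) (t : ℕ → K), (∀ l, c l < p) ∧ (∀ l, t l ∈ T) ∧
      MvPolynomial.aeval (fun i : Fin n => ∏ l ∈ range (L + 1), t l ^ (c l ^ (i : ℕ) % p)) f ≠ 0 := by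
  classical
  have hψ : ∃ x, ψ (treeProd g L 0 x) ≠ 0 := by
    by_contra! hcon
    refine hf0 (MvPolynomial.rename_injective _ Fin.val_injective ?_)
    rw [hf, map_zero]
    exact sum_eq_zero fun x _ => by rw [hcon, map_zero, zero_mul]
  obtain ⟨c, hc, x₀, hx₀, huniq⟩ := exists_isolated_term g hD L σ hσ hσm hlarge ψ hψ
  -- The exponents with which the term of `x` appears after substituting the new variables.
  let μ : TreeIdx D L → (Fin (L + 1) →₀ ℕ) := fun x =>
    Finsupp.equivFunOnFinite.symm fun l => powWeight p σ (c l) (treeExp L 0 x)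
  have hμ : ∀ x l, μ x l = powWeight p σ (c l) (treeExp L 0 x) := fun x l => rfl
  let G : MvPolynomial (Fin (L + 1)) K :=
    ∑ x : TreeIdx D L, MvPolynomial.monomial (μ x) (algebraMap F K (ψ (treeProd g L 0 x)))
  have hcoeff : ∀ m, G.coeff m = ∑ x : TreeIdx D L,
      if μ x = m then algebraMap F K (ψ (treeProd g L 0 x)) else 0 := by
    intro m
    simp only [G, MvPolynomial.coeff_sum, MvPolynomial.coeff_monomial]
  -- No other nonzero term lands on the monomial `μ x₀`, so nothing cancels there.
  have hG0 : G ≠ 0 := by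
    intro h0
    have h1 := hcoeff (μ x₀)
    rw [h0, MvPolynomial.coeff_zero, sum_eq_single x₀, if_pos rfl] at h1
    · exact hx₀ ((map_eq_zero _).1 h1.symm)
    · intro y _ hy
      split_ifs with hμy
      · by_contra hne
        refine hy (huniq y (fun h => hne (by rw [h, map_zero])) fun l hl => ?_)
        have := DFunLike.congr_fun hμy ⟨l, Nat.lt_succ_of_le hl⟩
        simpa [hμ] using this
      · rfl
    · intro h; exact absurd (mem_univ _) h
  obtain ⟨t, htT, ht⟩ : ∃ t : Fin (L + 1) → K, (∀ l, t l ∈ T) ∧ MvPolynomial.eval t G ≠ 0 := by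
    by_contra! hcon
    refine hG0 (MvPolynomial.eq_zero_of_eval_zero_at_prod_finset G (fun _ => T) (fun l => ?_) hcon)
    rw [MvPolynomial.degreeOf_lt_iff (by omega)]
    intro m hm
    rw [MvPolynomial.mem_support_iff, hcoeff] at hm
    obtain ⟨x, -, hx⟩ := exists_ne_zero_of_sum_ne_zero hm
    have hxm : μ x = m := by
      by_contra h
      exact hx (if_neg h)
    rw [← hxm, hμ]
    exact (powWeight_le hp.out.pos σ _ _ D _ (treeExp_support_subset le_rfl (by simp) x)
      (treeExp_apply_le _ _ _)).trans_lt hT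
  obtain ⟨t₀, ht₀⟩ := Finset.card_pos.1 (Nat.zero_lt_of_lt hT)
  let t' : ℕ → K := fun l => if h : l < L + 1 then t ⟨l, h⟩ else t₀
  refine ⟨c, t', hc, fun l => ?_, ?_⟩
  · simp only [t']
    split_ifs
    · exact htT _
    · exact ht₀
  let y : ℕ → K := fun i => ∏ l ∈ range (L + 1), t' l ^ (c l ^ i % p)
  have hy : MvPolynomial.aeval (fun i : Fin n => y i) f = MvPolynomial.eval t G := by
    have h1 : MvPolynomial.aeval (fun i : Fin n => y i) f =
        MvPolynomial.aeval y (MvPolynomial.rename Fin.val f) := by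
      rw [MvPolynomial.aeval_rename]; rfl
    rw [h1, hf, map_sum, map_sum]
    refine sum_congr rfl fun x _ => ?_
    rw [map_mul, MvPolynomial.aeval_C, MvPolynomial.eval_monomial]
    congr 1
    rw [map_finsuppProd, Finsupp.prod_fintype (μ x) _ (by simp)]
    simp only [map_pow, MvPolynomial.aeval_X, y, ← prod_pow, ← pow_mul]
    rw [Finsupp.prod, prod_comm, ← Fin.prod_univ_eq_prod_range
      (fun l => ∏ a ∈ (treeExp L 0 x).support, t' l ^ (c l ^ σ a % p * treeExp L 0 x a))]
    refine prod_congr rfl fun l _ => ?_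
    rw [prod_pow_eq_pow_sum, hμ, powWeight, Finsupp.weight_apply, Finsupp.sum]
    simp only [t', l.2, dif_pos, smul_eq_mul, mul_comm]
  rw [hy]
  exact ht

end BasisIsolation

/-! ## Programs with several passes as products of tensors -/

namespace BasisIsolation

open Finset

/-! ### Ordered products in a monoid. -/

section RangeProd

variable {A : Type*} [Monoid A]

/-- The ordered product of `G i` for `s ≤ i < s + m`. -/
def rangeProd (G : ℕ → A) (s m : ℕ) : A := ((List.range m).map fun i => G (s + i)).prod

@[simp] lemma rangeProd_zero (G : ℕ → A) (s : ℕ) : rangeProd G s 0 = 1 := by simp [rangeProd]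

lemma rangeProd_succ (G : ℕ → A) (s m : ℕ) :
    rangeProd G s (m + 1) = rangeProd G s m * G (s + m) := by
  simp [rangeProd, List.range_succ]

lemma rangeProd_add (G : ℕ → A) (s l m : ℕ) :
    rangeProd G s (l + m) = rangeProd G s l * rangeProd G (s + l) m := by
  induction m with
  | zero => simp
  | succ m ih => rw [← add_assoc, rangeProd_succ, rangeProd_succ, ih, mul_assoc, add_assoc]

lemma rangeProd_congr {G G' : ℕ → A} (s m : ℕ) (h : ∀ i < m, G (s + i) = G' (s + i)) :
    rangeProd G s m = rangeProd G' s m := by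
  unfold rangeProd
  congr 1
  exact List.map_congr_left fun i hi => h i (List.mem_range.1 hi)

lemma rangeProd_mul (G : ℕ → A) (n k : ℕ) :
    rangeProd G 0 (k * n) = rangeProd (fun q => rangeProd (fun a => G (q * n + a)) 0 n) 0 k := by
  induction k with
  | zero => simp
  | succ k ih =>
    rw [Nat.succ_mul, rangeProd_add, ih, rangeProd_succ]
    simp [rangeProd]

end RangeProd

/-! ### Kronecker products and the entries of matrix products. -/

section Tensor

variable {R ι : Type*} [CommRing R]

/-- The Kronecker product of `k` matrices. -/
def piKronecker {k : ℕ} (M : Fin k → Matrix ι ι R) : Matrix (Fin k → ι) (Fin k → ι) R :=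
  Matrix.of fun u v => ∏ q, M q (u q) (v q)

lemma piKronecker_one [DecidableEq ι] {k : ℕ} :
    piKronecker (fun _ : Fin k => (1 : Matrix ι ι R)) = 1 := by
  ext u v
  simp only [piKronecker, Matrix.of_apply, Matrix.one_apply, prod_ite_zero, prod_const_one,
    funext_iff, mem_univ, true_implies]

/-- Expanding a product of `k` sums chooses one intermediate vertex per pass, that is, one
intermediate index of the Kronecker product. -/
lemma piKronecker_mul [Fintype ι] {k : ℕ} (M N : Fin k → Matrix ι ι R) :
    piKronecker (fun q => M q * N q) = piKronecker M * piKronecker N := by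
  ext u v
  simp only [piKronecker, Matrix.of_apply, Matrix.mul_apply, prod_univ_sum, Fintype.piFinset_univ,
    prod_mul_distrib]

variable [Fintype ι] [DecidableEq ι]

lemma rangeProd_piKronecker {k : ℕ} (M : Fin k → ℕ → Matrix ι ι R) (s m : ℕ) :
    rangeProd (fun a => piKronecker fun q => M q a) s m =
      piKronecker fun q => rangeProd (M q) s m := by
  induction m with
  | zero => simp [piKronecker_one]
  | succ m ih => simp only [rangeProd_succ, ih, piKronecker_mul]

lemma rangeProd_apply (N : ℕ → Matrix ι ι R) (m : ℕ) (i j : ι) :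
    rangeProd N 0 m i j = ∑ b : Fin (m + 1) → ι,
      if b 0 = i ∧ b (Fin.last m) = j then ∏ l : Fin m, N l (b l.castSucc) (b l.succ) else 0 := by
  induction m generalizing j with
  | zero =>
    rw [rangeProd_zero, Matrix.one_apply,
      ← Equiv.sum_comp (Equiv.funUnique (Fin 1) ι).symm]
    simp only [Fin.last_zero, Equiv.funUnique_symm_apply, uniqueElim_const, univ_eq_empty,
      prod_empty]
    rw [sum_eq_single i]
    · simp
    · intro b _ hb
      rw [if_neg (fun h => hb h.1)]
    · intro h; exact absurd (mem_univ _) h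
  | succ m ih =>
    rw [rangeProd_succ, Matrix.mul_apply, ← Equiv.sum_comp (Fin.snocEquiv fun _ => ι),
      Fintype.sum_prod_type]
    symm
    rw [sum_eq_single j]
    · simp only [ih, sum_mul]
      rw [sum_comm]
      refine sum_congr rfl fun b _ => ?_
      have h0 : (Fin.snoc b j : Fin (m + 2) → ι) 0 = b 0 := by
        rw [← Fin.castSucc_zero, Fin.snoc_castSucc]
      symm
      rw [sum_eq_single (b (Fin.last m))]
      · simp only [Fin.snocEquiv, Equiv.coe_fn_mk, h0, Fin.snoc_last, and_true,
          Fin.prod_univ_castSucc, Fin.snoc_castSucc, zero_add, ite_mul, zero_mul]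
        congr 1
        simp only [Fin.succ_last, Fin.snoc_last, Fin.val_last, Fin.val_castSucc]
        congr 1
        refine prod_congr rfl fun l _ => ?_
        rw [Fin.succ_castSucc, Fin.snoc_castSucc]
      · intro u _ hu
        rw [if_neg (fun h => hu h.2.symm), zero_mul]
      · intro h; exact absurd (mem_univ _) h
    · intro u _ hu
      refine sum_eq_zero fun b _ => if_neg fun h => hu ?_
      simpa [Fin.snocEquiv] using h.2
    · intro h; exact absurd (mem_univ _) h

/-- The functional that takes the Kronecker product of `k` matrices to the entry at `(o, o)` of
their ordered product. -/
def closedPaths (R : Type*) [CommRing R] {ι : Type*} [Fintype ι] [DecidableEq ι] (k : ℕ) (o : ι) :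
    Matrix (Fin k → ι) (Fin k → ι) R →ₗ[R] R :=
  ∑ b : Fin (k + 1) → ι, if b 0 = o ∧ b (Fin.last k) = o then
    Matrix.entryLinearMap R R (fun q : Fin k => b q.castSucc) (fun q : Fin k => b q.succ) else 0

lemma closedPaths_apply (k : ℕ) (o : ι) (M : Matrix (Fin k → ι) (Fin k → ι) R) :
    closedPaths R k o M = ∑ b : Fin (k + 1) → ι, if b 0 = o ∧ b (Fin.last k) = o then
      M (fun q => b q.castSucc) (fun q => b q.succ) else 0 := by
  simp only [closedPaths, LinearMap.sum_apply]
  refine sum_congr rfl fun b _ => ?_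
  split_ifs <;> simp

/-- Fixing the vertices `b` at which the passes begin and end, the summand `∏ N q (b q) (b (q + 1))`
is a single entry of the Kronecker product. This makes the composition of the passes linear in it.
-/
lemma closedPaths_piKronecker (k : ℕ) (o : ι) (N : ℕ → Matrix ι ι R) :
    closedPaths R k o (piKronecker fun q : Fin k => N q) = rangeProd N 0 k o o := by
  rw [closedPaths_apply, rangeProd_apply]
  rfl

lemma closedPaths_map {S : Type*} [CommRing S] (φ : R →+* S) (k : ℕ) (o : ι)
    (M : Matrix (Fin k → ι) (Fin k → ι) R) :
    closedPaths S k o (φ.mapMatrix M) = φ (closedPaths R k o M) := by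
  simp only [closedPaths_apply, map_sum, apply_ite φ, map_zero]
  rfl

end Tensor

/-- Expanding an ordered product of polynomials with coefficients `g a e`. -/
lemma sum_treeProd {A B R : Type*} [Ring A] [CommRing R] [Ring B] [Algebra R B] {D : ℕ}
    (φ : A →+* B) (g : ℕ → Fin (D + 1) → A) (Y : ℕ → R) (G : ℕ → B)
    (hG : ∀ a, G a = ∑ e : Fin (D + 1), Y a ^ (e : ℕ) • φ (g a e)) (j a : ℕ) :
    ∑ x : TreeIdx D j, ((treeExp j a x).prod fun i m => Y i ^ m) • φ (treeProd g j a x) =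
      rangeProd G (a * 2 ^ j) (2 ^ j) := by
  induction j generalizing a with
  | zero =>
    have h1 : rangeProd G (a * 2 ^ 0) (2 ^ 0) = G a := by simp [rangeProd]
    rw [h1, hG]
    refine sum_congr rfl fun e _ => ?_
    exact congrArg (· • φ (g a e))
      (Finsupp.prod_single_index (h := fun i m => Y i ^ m) (pow_zero _))
  | succ j ih =>
    have h1 : rangeProd G (a * 2 ^ (j + 1)) (2 ^ (j + 1)) =
        rangeProd G (2 * a * 2 ^ j) (2 ^ j) * rangeProd G ((2 * a + 1) * 2 ^ j) (2 ^ j) := by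
      have e1 : a * 2 ^ (j + 1) = 2 * a * 2 ^ j := by ring
      have e2 : (2 * a + 1) * 2 ^ j = 2 * a * 2 ^ j + 2 ^ j := by ring
      have e3 : 2 ^ (j + 1) = 2 ^ j + 2 ^ j := by ring
      rw [e1, e2, ← rangeProd_add, ← e3]
    rw [h1, ← ih, ← ih, sum_mul_sum, ← Fintype.sum_prod_type']
    refine sum_congr rfl fun x _ => ?_
    simp only [treeExp, treeProd, map_mul]
    rw [Finsupp.prod_add_index' (fun _ => pow_zero _) (fun _ _ _ => pow_add _ _ _),
      smul_mul_smul_comm]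

end BasisIsolation

/-! ### Programs as products of square matrices. -/

namespace ObliviousABP

open Finset BasisIsolation

variable {F : Type*} [Field F] {n : ℕ}

open Classical in
/-- The labels of a program of width at most `w` as matrices of size `w`, padded by zeros. -/
noncomputable def paddedLabel (A : ObliviousABP F n) (w l : ℕ) (u v : Fin w) : Polynomial F :=
  if h : ∃ hl : l < A.length, (u : ℕ) < A.size (Fin.castSucc ⟨l, hl⟩) ∧
      (v : ℕ) < A.size (Fin.succ ⟨l, hl⟩) then
    A.label ⟨l, h.1⟩ ⟨u, h.2.1⟩ ⟨v, h.2.2⟩ else 0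

lemma natDegree_paddedLabel_le {A : ObliviousABP F n} {d : ℕ} (hd : A.DegreeLE d) (w l : ℕ)
    (u v : Fin w) : (A.paddedLabel w l u v).natDegree ≤ d := by
  unfold paddedLabel
  split_ifs
  · exact hd _ _ _
  · simp

/-- Paths embed into the index sequences of the padded product. Any other sequence visits a padding
vertex, and a label next to it is `0`; for the last layer this is the incoming label, which exists
as the length is positive. -/
lemma map_computed {A : ObliviousABP F n} {w : ℕ} (hw : A.WidthLE w) (o : Fin w)
    (ho : (o : ℕ) = 0) (hlen : 0 < A.length) {R : Type*} [CommRing R] [Algebra F R]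
    (φ : MvPolynomial (Fin n) F →ₐ[F] R) (Y : ℕ → R)
    (hY : ∀ l : Fin A.length, Y l = φ (MvPolynomial.X (A.var l))) :
    φ A.computed =
      rangeProd (fun l => Matrix.of fun u v => Polynomial.aeval (Y l) (A.paddedLabel w l u v))
        0 A.length o o := by
  classical
  rw [rangeProd_apply, ← sum_filter, computed, map_sum]
  refine sum_of_injOn (fun p l => Fin.castLE (hw l) (p l)) ?_ ?_ ?_ ?_
  · intro p _ p' _ h
    funext l
    exact Fin.castLE_injective (hw l) (congrFun h l)
  · intro p _
    have h0 : (p 0 : ℕ) = 0 := by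
      have := (p 0).2; have := A.size_source; omega
    have h1 : (p (Fin.last _) : ℕ) = 0 := by
      have := (p (Fin.last _)).2; have := A.size_sink; omega
    simp only [coe_filter, mem_univ, true_and, Set.mem_ofPred_eq, Fin.ext_iff, Fin.val_castLE, ho]
    exact ⟨h0, h1⟩
  · intro b hb hnot
    obtain ⟨l, hl⟩ : ∃ l, ¬ (b l : ℕ) < A.size l := by
      by_contra! hcon
      refine hnot ⟨fun l => ⟨b l, hcon l⟩, by simp, ?_⟩
      funext l
      rfl
    rcases Fin.eq_castSucc_or_eq_last l with ⟨i, rfl⟩ | rfl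
    · refine prod_eq_zero (mem_univ i) ?_
      have : A.paddedLabel w i (b i.castSucc) (b i.succ) = 0 :=
        dif_neg fun ⟨_, h, _⟩ => hl h
      exact (congrArg (Polynomial.aeval _) this).trans (map_zero _)
    · refine prod_eq_zero (mem_univ (⟨A.length - 1, by omega⟩ : Fin A.length)) ?_
      have hs : Fin.succ (⟨A.length - 1, by omega⟩ : Fin A.length) = Fin.last _ := by
        ext; simp; omega
      have : A.paddedLabel w (A.length - 1) (b (Fin.castSucc ⟨A.length - 1, by omega⟩))
          (b (Fin.succ ⟨A.length - 1, by omega⟩)) = 0 := by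
        refine dif_neg fun ⟨_, _, h⟩ => hl ?_
        rw [hs] at h
        exact h
      exact (congrArg (Polynomial.aeval _) this).trans (map_zero _)
  · intro p _
    rw [pathValue, map_prod]
    refine prod_congr rfl fun l _ => ?_
    have hpl : A.paddedLabel w l (Fin.castLE (hw _) (p l.castSucc))
        (Fin.castLE (hw _) (p l.succ)) = A.label l (p l.castSucc) (p l.succ) :=
      dif_pos (⟨l.2, (p l.castSucc).2, (p l.succ).2⟩ : ∃ hl : (l : ℕ) < A.length, _ ∧ _)
    simp only [Matrix.of_apply]
    rw [hpl, hY, Polynomial.aeval_algHom_apply]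

end ObliviousABP

/-! ### From several passes to one product. -/

namespace BasisIsolation

open Finset

/-- A polynomial with a `k`-pass program is read off a product along a tree, with coefficients in
the matrix algebra of dimension `w ^ (2 * k)`. -/
theorem exists_treeProd_of_mem_kPassPolys {F : Type*} [Field F] {n k w d : ℕ} (hn : 0 < n)
    (hk : 0 < k) (hw : 0 < w) {f : MvPolynomial (Fin n) F} (hf : f ∈ kPassPolys F n k w d)
    {L : ℕ} (hL : n ≤ 2 ^ L) :
    ∃ (σ : ℕ → ℕ) (g : ℕ → Fin (k * d + 1) → Matrix (Fin k → Fin w) (Fin k → Fin w) F)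
      (ψ : Matrix (Fin k → Fin w) (Fin k → Fin w) F →ₗ[F] F),
      Set.InjOn σ (Set.Iio (2 ^ L)) ∧ (∀ i < 2 ^ L, σ i < 2 ^ L) ∧
      MvPolynomial.rename Fin.val f = ∑ x : TreeIdx (k * d) L,
        MvPolynomial.C (ψ (treeProd g L 0 x)) *
          (treeExp L 0 x).prod fun a m => (MvPolynomial.X (σ a) : MvPolynomial ℕ F) ^ m := by
  classical
  obtain ⟨A, ⟨hlen, π, hπ⟩, hwidth, hdeg, rfl⟩ := hf
  -- The variable read at position `a`. Positions from `n` on are padding up to a power of two;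
  -- fixing them keeps `σ` injective.
  let σ : ℕ → ℕ := fun a => if h : a < n then π ⟨a, h⟩ else a
  have hσ_lt : ∀ a (h : a < n), σ a = π ⟨a, h⟩ := fun a h => dif_pos h
  have hσ_ge : ∀ a, ¬ a < n → σ a = a := fun a h => dif_neg h
  let o : Fin w := ⟨0, hw⟩
  let Y : ℕ → MvPolynomial ℕ F := fun a => MvPolynomial.X (σ a)
  let N : ℕ → Matrix (Fin w) (Fin w) (MvPolynomial ℕ F) := fun l =>
    Matrix.of fun u v => Polynomial.aeval (Y (l % n)) (A.paddedLabel w l u v)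
  have hcomp : MvPolynomial.rename Fin.val A.computed = rangeProd N 0 (k * n) o o := by
    rw [← hlen]
    refine ObliviousABP.map_computed hwidth o rfl (by rw [hlen]; positivity) _ (fun l => Y (l % n))
      fun l => ?_
    have hmod := Nat.mod_lt (l : ℕ) hn
    rw [MvPolynomial.rename_X, hπ l ⟨l % n, hmod⟩ rfl]
    exact congrArg MvPolynomial.X (hσ_lt _ hmod)
  -- An entry of the factor for position `a`: all `k` readings of its variable multiplied together,
  -- whence the degree `k * d`.
  let P : ℕ → (Fin k → Fin w) → (Fin k → Fin w) → Polynomial F := fun a u v =>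
    ∏ q : Fin k, A.paddedLabel w (q * n + a) (u q) (v q)
  have hPdeg : ∀ a u v, (P a u v).natDegree < k * d + 1 := fun a u v => by
    refine Nat.lt_succ_of_le ((Polynomial.natDegree_prod_le _ _).trans ?_)
    refine (sum_le_card_nsmul _ _ d fun q _ =>
      ObliviousABP.natDegree_paddedLabel_le hdeg _ _ _ _).trans (by simp)
  -- At padding positions the factor is the constant `1`.
  let g : ℕ → Fin (k * d + 1) → Matrix (Fin k → Fin w) (Fin k → Fin w) F := fun a e =>
    if a < n then Matrix.of fun u v => (P a u v).coeff e else if (e : ℕ) = 0 then 1 else 0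
  let φ : Matrix (Fin k → Fin w) (Fin k → Fin w) F →+*
    Matrix (Fin k → Fin w) (Fin k → Fin w) (MvPolynomial ℕ F) := RingHom.mapMatrix MvPolynomial.C
  let G : ℕ → Matrix (Fin k → Fin w) (Fin k → Fin w) (MvPolynomial ℕ F) := fun a =>
    if a < n then piKronecker fun q : Fin k => N (q * n + a) else 1
  have hG : ∀ a, G a = ∑ e : Fin (k * d + 1),
      Y a ^ (e : ℕ) • φ (g a e) := by
    intro a
    by_cases ha : a < n
    · simp only [G, g, if_pos ha]
      ext1 u v
      rw [Matrix.sum_apply]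
      have h1 : piKronecker (fun q : Fin k => N (q * n + a)) u v =
          Polynomial.aeval (Y a) (P a u v) := by
        simp only [piKronecker, N, P, Matrix.of_apply, map_prod, Nat.mul_add_mod',
          Nat.mod_eq_of_lt ha]
      rw [h1, Polynomial.aeval_eq_sum_range' (hPdeg a u v), ← Fin.sum_univ_eq_sum_range
        (fun e => (P a u v).coeff e • Y a ^ e)]
      refine sum_congr rfl fun e _ => ?_
      simp [φ, MvPolynomial.smul_eq_C_mul, mul_comm]
    · simp only [G, g, if_neg ha]
      rw [sum_eq_single 0]
      · rw [Fin.val_zero, if_pos rfl, map_one, pow_zero, one_smul]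
      · intro e _ he
        have : (e : ℕ) ≠ 0 := fun h => he (Fin.ext h)
        simp [this]
      · simp
  -- The interchange of passes and positions, by multiplicativity of the Kronecker product.
  have hGprod : rangeProd G 0 (2 ^ L) =
      piKronecker fun q : Fin k => rangeProd (fun a => N (q * n + a)) 0 n := by
    have h1 : 2 ^ L = n + (2 ^ L - n) := by omega
    have h2 : rangeProd G (0 + n) (2 ^ L - n) = 1 := by
      refine List.prod_eq_one fun x hx => ?_
      obtain ⟨i, -, rfl⟩ := List.mem_map.1 hx
      exact if_neg (by omega)
    rw [h1, rangeProd_add, h2, mul_one, ← rangeProd_piKronecker]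
    exact rangeProd_congr _ _ fun i hi => if_pos (by omega)
  refine ⟨σ, g, closedPaths F k o, ?_, ?_, ?_⟩
  · refine Function.Injective.injOn fun a b h => ?_
    by_cases ha : a < n <;> by_cases hb : b < n
    · rw [hσ_lt a ha, hσ_lt b hb] at h
      simpa using π.injective (Fin.ext h)
    · rw [hσ_lt a ha, hσ_ge b hb] at h
      exact absurd (h ▸ (π ⟨a, ha⟩).2) hb
    · rw [hσ_ge a ha, hσ_lt b hb] at h
      exact absurd (h ▸ (π ⟨b, hb⟩).2) ha
    · rwa [hσ_ge a ha, hσ_ge b hb] at h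
  · intro i hi
    by_cases h : i < n
    · rw [hσ_lt i h]
      exact (π ⟨i, h⟩).2.trans_le hL
    · rwa [hσ_ge i h]
  · have h1 := sum_treeProd φ g Y G hG L 0
    rw [zero_mul, hGprod] at h1
    rw [hcomp, rangeProd_mul, ← closedPaths_piKronecker, ← h1, map_sum]
    refine sum_congr rfl fun x _ => ?_
    rw [map_smul, closedPaths_map, smul_eq_mul, mul_comm]

end BasisIsolation

/-! ## The hitting set -/

namespace BasisIsolation

open Finset

/-- The list `α`, continued by zeros. -/
def extendList {K : Type*} [Zero K] {N : ℕ} (α : Fin N → K) (i : ℕ) : K :=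
  if h : i < N then α ⟨i, h⟩ else 0

/-- The point encoded by the base `b` digits of `z`: three digits for every level `l < m`, of which
two determine exponents and one selects an element of the list. -/
def digitPoint {K : Type*} [CommMonoid K] (a : ℕ → K) (b m z i : ℕ) : K :=
  ∏ l ∈ range m, a (z / b ^ (3 * l + 2) % b) ^
    ((z / b ^ (3 * l) % b) ^ i % (z / b ^ (3 * l + 1) % b + 2))

lemma exists_digits {b m : ℕ} (c p s : ℕ → ℕ) (hc : ∀ l, c l < b) (hp : ∀ l, p l < b)
    (hs : ∀ l, s l < b) : ∃ z < b ^ (3 * m), ∀ l < m, z / b ^ (3 * l) % b = c l ∧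
      z / b ^ (3 * l + 1) % b = p l ∧ z / b ^ (3 * l + 2) % b = s l := by
  let δ : Fin (3 * m) → Fin b := fun j =>
    if (j : ℕ) % 3 = 0 then ⟨c (j / 3), hc _⟩ else if (j : ℕ) % 3 = 1 then ⟨p (j / 3), hp _⟩
    else ⟨s (j / 3), hs _⟩
  have hδ : ∀ j : Fin (3 * m), (finFunctionFinEquiv δ : ℕ) / b ^ (j : ℕ) % b = δ j := by
    intro j
    have := congrArg Fin.val (congrFun (finFunctionFinEquiv.symm_apply_apply δ) j)
    rwa [finFunctionFinEquiv_symm_apply_val] at this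
  refine ⟨finFunctionFinEquiv δ, (finFunctionFinEquiv δ).2, fun l hl => ⟨?_, ?_, ?_⟩⟩
  · refine (hδ ⟨3 * l, by omega⟩).trans ?_
    simp only [δ]
    rw [if_pos (by omega), show 3 * l / 3 = l by omega]
  · refine (hδ ⟨3 * l + 1, by omega⟩).trans ?_
    simp only [δ]
    rw [if_neg (by omega), if_pos (by omega), show (3 * l + 1) / 3 = l by omega]
  · refine (hδ ⟨3 * l + 2, by omega⟩).trans ?_
    simp only [δ]
    rw [if_neg (by omega), if_neg (by omega), show (3 * l + 2) / 3 = l by omega]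

lemma two_pow_clog_le {n : ℕ} (hn : 2 ≤ n) : 2 ^ Nat.clog 2 n ≤ 2 * n := by
  have h1 := Nat.pow_pred_clog_lt_self (b := 2) (by norm_num) (by omega : 1 < n)
  have h2 : 0 < Nat.clog 2 n := Nat.clog_pos (by norm_num) hn
  rw [← Nat.succ_pred_eq_of_pos h2, pow_succ]
  omega

/-- The product `n k d w ^ (2 k)`, in which the list length is measured. -/
def sizeParam (n k w d : ℕ) : ℕ := n * k * d * w ^ (2 * k)

lemma exists_digitPoint_ne_zero {F K : Type*} [Field F] [Field K] [Algebra F K] {n k w d N : ℕ}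
    (hn : 2 ≤ n) (hk : 1 ≤ k) (hw : 1 ≤ w) (hd : 1 ≤ d) {α : Fin N → K}
    (hα : Function.Injective α) (hN : sizeParam n k w d ^ 16 ≤ N)
    {f : MvPolynomial (Fin n) F} (hf : f ∈ kPassPolys F n k w d) (hf0 : f ≠ 0) :
    ∃ z < (sizeParam n k w d ^ 16) ^ (3 * (Nat.clog 2 n + 1)),
      MvPolynomial.aeval (fun i : Fin n => digitPoint (extendList α) (sizeParam n k w d ^ 16)
        (Nat.clog 2 n + 1) z i) f ≠ 0 := by
  classical
  set T := sizeParam n k w d with hTdef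
  set L := Nat.clog 2 n
  set r := w ^ (2 * k)
  have hr : 1 ≤ r := Nat.one_le_pow _ _ hw
  have hnT : n ≤ T := by
    calc n = n * 1 * 1 * 1 := by ring
      _ ≤ n * k * d * r := by gcongr
  have hrT : r ≤ T := by
    calc r = 1 * 1 * 1 * r := by ring
      _ ≤ n * k * d * r := by gcongr; omega
  have hDT : n * (k * d) ≤ T := by
    calc n * (k * d) = n * k * d * 1 := by ring
      _ ≤ n * k * d * r := by gcongr
  have hT2 : 2 ≤ T := hn.trans hnT
  have hL2 : 2 ^ L ≤ 2 * n := two_pow_clog_le hn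
  have hL1 : n ≤ 2 ^ L := Nat.le_pow_clog (by norm_num) n
  -- Bertrand's postulate. The separation step needs `p > 2 ^ L * r ^ 4 * 2 ^ L`, which is at most
  -- `T ^ 8`; with `p ≤ T ^ 9` the degrees in the new variables are at most `T ^ 11`, so `T ^ 16` is
  -- a common bound for all digits.
  obtain ⟨p, hpp, hpgt, hple⟩ := Nat.exists_prime_lt_and_le_two_mul (T ^ 8) (by positivity)
  have : Fact p.Prime := ⟨hpp⟩
  have hp9 : p ≤ T ^ 9 := hple.trans <| by
    calc 2 * T ^ 8 ≤ T * T ^ 8 := Nat.mul_le_mul_right _ hT2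
      _ = T ^ 9 := by ring
  have hp16 : p < T ^ 16 := hp9.trans_lt (Nat.pow_lt_pow_right (by omega) (by norm_num))
  have hDp : k * d < p := by
    calc k * d ≤ n * (k * d) := Nat.le_mul_of_pos_left _ (by omega)
      _ ≤ T ^ 1 := by simpa using hDT
      _ ≤ T ^ 8 := Nat.pow_le_pow_right (by omega) (by norm_num)
      _ < p := hpgt
  have hrank : Module.finrank F (Matrix (Fin k → Fin w) (Fin k → Fin w) F) = r := by
    rw [Module.finrank_matrix]
    simp only [Fintype.card_fun, Fintype.card_fin, Module.finrank_self, mul_one, r]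
    ring
  have hlarge : 2 ^ L * Module.finrank F (Matrix (Fin k → Fin w) (Fin k → Fin w) F) ^ 4 * 2 ^ L
      < p := by
    rw [hrank]
    calc 2 ^ L * r ^ 4 * 2 ^ L ≤ (T * T) * T ^ 4 * (T * T) := by
          gcongr <;> exact hL2.trans (Nat.mul_le_mul hT2 hnT)
      _ = T ^ 8 := by ring
      _ < p := hpgt
  have hdeg : 2 ^ L * (k * d * p) < T ^ 16 := by
    calc 2 ^ L * (k * d * p) ≤ 2 * n * (k * d * p) := Nat.mul_le_mul_right _ hL2
      _ = 2 * (n * (k * d)) * p := by ring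
      _ ≤ T * T * T ^ 9 := by gcongr
      _ = T ^ 11 := by ring
      _ < T ^ 16 := Nat.pow_lt_pow_right (by omega) (by norm_num)
  let U : Finset K := univ.image fun s : Fin (T ^ 16) => α ⟨s, s.2.trans_le hN⟩
  have hU : U.card = T ^ 16 := by
    rw [card_image_of_injective _ fun s s' h => Fin.ext (Fin.mk.inj (hα h)), card_univ,
      Fintype.card_fin]
  obtain ⟨σ, g, ψ, hσ, hσm, hrep⟩ :=
    exists_treeProd_of_mem_kPassPolys (by omega) hk hw hf hL1
  obtain ⟨c, t, hc, ht, hne⟩ := exists_aeval_ne_zero g hDp L σ hσ hσm hlarge ψ f hrep hf0 U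
    (by rwa [hU])
  have hs : ∀ l, ∃ s, s < T ^ 16 ∧ t l = extendList α s := by
    intro l
    obtain ⟨s, -, hs⟩ := mem_image.1 (ht l)
    exact ⟨s, s.2, by rw [extendList, dif_pos (s.2.trans_le hN), ← hs]⟩
  choose s hs hts using hs
  -- The digit `p - 2` stands for the modulus `p`: with the shift by `2` every digit gives a modulus
  -- at least `2`, so no primality test is needed.
  obtain ⟨z, hz, hdig⟩ := exists_digits (b := T ^ 16) (m := L + 1) c (fun _ => p - 2) s
    (fun l => (hc l).trans hp16) (fun _ => by omega) hs
  refine ⟨z, hz, ?_⟩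
  convert hne using 3
  funext i
  refine prod_congr rfl fun l hl => ?_
  obtain ⟨h1, h2, h3⟩ := hdig l (mem_range.1 hl)
  rw [h1, h2, h3, hts, Nat.sub_add_cancel hpp.two_le]

end BasisIsolation

/-! ## Verified program fragments -/

namespace BlackBoxRAM

section Frame

variable {K : Type*} {n : ℕ}

/-- The states differ at most in the number cells of the list `l`. -/
structure Frame (l : List ℕ) (s s' : State K n) : Prop where
  reg : ∀ r, r ∉ l → s'.reg r = s.reg r
  mem : s'.mem = s.mem
  asked : s'.asked = s.asked

lemma Frame.refl (l : List ℕ) (s : State K n) : Frame l s s := ⟨fun _ _ => rfl, rfl, rfl⟩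

lemma Frame.trans {l l' l'' : List ℕ} {s s' s'' : State K n} (h : Frame l s s')
    (h' : Frame l' s' s'') (hl : l ⊆ l'') (hl' : l' ⊆ l'') : Frame l'' s s'' where
  reg := fun r hr => (h'.reg r fun hm => hr (hl' hm)).trans (h.reg r fun hm => hr (hl hm))
  mem := h'.mem.trans h.mem
  asked := h'.asked.trans h.asked

/-- Cell `10` holds `0` and cell `11` holds `1`. -/
def Consts (s : State K n) : Prop := s.reg 10 = 0 ∧ s.reg 11 = 1

lemma Consts.frame {l : List ℕ} {s s' : State K n} (h : Consts s) (hf : Frame l s s')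
    (h10 : 10 ∉ l) (h11 : 11 ∉ l) : Consts s' :=
  ⟨(hf.reg 10 h10).trans h.1, (hf.reg 11 h11).trans h.2⟩

end Frame

variable {K : Type*} [Field K] {n : ℕ}

/-- Started in `s`, the program `P` halts after at most `T` steps in a state that satisfies `Q`. -/
def Ends (E : Env K n) (P : Prog) (s : State K n) (T : ℕ) (Q : State K n → Prop) : Prop :=
  ∃ t s', Exec E P s t s' ∧ t ≤ T ∧ Q s'

namespace Ends

variable {E : Env K n} {P P' : Prog} {s : State K n} {T T' : ℕ} {Q Q' : State K n → Prop}

lemma le (h : Ends E P s T Q) (hT : T ≤ T') : Ends E P s T' Q := by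
  obtain ⟨t, s', he, ht, hQ⟩ := h
  exact ⟨t, s', he, ht.trans hT, hQ⟩

lemma imp (h : Ends E P s T Q) (hQ : ∀ s', Q s' → Q' s') : Ends E P s T Q' := by
  obtain ⟨t, s', he, ht, h⟩ := h
  exact ⟨t, s', he, ht, hQ s' h⟩

lemma instr {i : Instr} (h : Q (i.apply E s)) : Ends E (.instr i) s 1 Q :=
  ⟨1, _, .instr i s, le_rfl, h⟩

lemma seq (h : Ends E P s T Q) (h' : ∀ s', Q s' → Ends E P' s' T' Q') :
    Ends E (.seq P P') s (T + T') Q' := by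
  obtain ⟨t, s', he, ht, hQ⟩ := h
  obtain ⟨t', s'', he', ht', hQ'⟩ := h' s' hQ
  exact ⟨_, _, he.seq he', by omega, hQ'⟩

lemma step {i : Instr} (h : Ends E P (i.apply E s) T Q) :
    Ends E (.seq (.instr i) P) s (T + 1) Q := by
  obtain ⟨t, s', he, ht, hQ⟩ := h
  exact ⟨_, _, (Exec.instr i s).seq he, by omega, hQ⟩

lemma ifZero {a : ℕ} (h : s.reg a = 0 → Ends E P s T Q) (h' : s.reg a ≠ 0 → Ends E P' s T Q) :
    Ends E (.ifZero a P P') s (T + 1) Q := by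
  by_cases ha : s.reg a = 0
  · obtain ⟨t, s', he, ht, hQ⟩ := h ha
    exact ⟨_, _, .ifZero_true ha he, by omega, hQ⟩
  · obtain ⟨t, s', he, ht, hQ⟩ := h' ha
    exact ⟨_, _, .ifZero_false ha he, by omega, hQ⟩

lemma ifFieldZero {a : ℕ} (h : s.mem a = 0 → Ends E P s T Q)
    (h' : s.mem a ≠ 0 → Ends E P' s T Q) : Ends E (.ifFieldZero a P P') s (T + 1) Q := by
  by_cases ha : s.mem a = 0
  · obtain ⟨t, s', he, ht, hQ⟩ := h ha
    exact ⟨_, _, .ifFieldZero_true ha he, by omega, hQ⟩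
  · obtain ⟨t, s', he, ht, hQ⟩ := h' ha
    exact ⟨_, _, .ifFieldZero_false ha he, by omega, hQ⟩

/-- Each round costs one test besides its body, and the final failing test costs one more step. -/
lemma loop {a : ℕ} (I : ℕ → State K n → Prop) (N τ : ℕ) (h0 : I 0 s)
    (hstep : ∀ j < N, ∀ s', I j s' → s'.reg a ≠ 0 ∧ Ends E P s' τ (I (j + 1)))
    (hend : ∀ s', I N s' → s'.reg a = 0) : Ends E (.loop a P) s (N * (τ + 1) + 1) (I N) := by
  have key : ∀ m j, j + m = N → ∀ s', I j s' →
      Ends E (.loop a P) s' (m * (τ + 1) + 1) (I N) := by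
    intro m
    induction m with
    | zero =>
      intro j hj s' hs'
      obtain rfl : j = N := by omega
      exact ⟨1, s', .loop_done (hend _ hs'), by omega, hs'⟩
    | succ m ih =>
      intro j hj s' hs'
      obtain ⟨hne, t, s'', he, ht, hI⟩ := hstep j (by omega) s' hs'
      obtain ⟨t', s₃, he', ht', hI'⟩ := ih (j + 1) (by omega) s'' hI
      exact ⟨_, _, .loop_step hne he he', by rw [Nat.succ_mul]; omega, hI'⟩
  exact key N 0 (by omega) s h0

lemma countdown {a : ℕ} (I : ℕ → State K n → Prop) (N τ : ℕ) (hN : s.reg a = N) (h0 : I 0 s)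
    (hstep : ∀ j < N, ∀ s', I j s' → s'.reg a = N - j →
      Ends E P s' τ fun s'' => I (j + 1) s'' ∧ s''.reg a = N - (j + 1)) :
    Ends E (.loop a P) s (N * (τ + 1) + 1) (I N) := by
  refine imp (loop (fun j s' => I j s' ∧ s'.reg a = N - j) N τ ⟨h0, by omega⟩ ?_ ?_)
    fun s' h => h.1
  · rintro j hj s' ⟨hI, ha⟩
    exact ⟨by omega, hstep j hj s' hI ha⟩
  · rintro s' ⟨-, ha⟩
    omega

end Ends

variable {E : Env K n}

/-- Cell `a` becomes the product of cells `b` and `c`. -/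
def mulProg (a b c : ℕ) : Prog :=
  .seq (.instr (.const a 0)) <| .seq (.instr (.add 50 b 10)) <|
    .loop 50 <| .seq (.instr (.add a a c)) (.instr (.sub 50 50 11))

lemma mulProg_ends {s : State K n} (hs : Consts s) (a b c : ℕ) (hab : a ≠ b) (hac : a ≠ c)
    (ha : a ∉ [10, 11, 50]) (hc : c ≠ 50) :
    Ends E (mulProg a b c) s (3 * s.reg b + 3) fun s' =>
      Frame [a, 50] s s' ∧ s'.reg a = s.reg b * s.reg c := by
  simp only [List.mem_cons, List.not_mem_nil, or_false, not_or] at ha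
  obtain ⟨ha10, ha11, ha50⟩ := ha
  obtain ⟨h10, h11⟩ := hs
  refine Ends.le (.step (.step (.countdown
    (fun j s' => Frame [a, 50] s s' ∧ s'.reg a = j * s.reg c) (s.reg b) 2 ?_ ?_ ?_))) (by omega)
  · simp [Instr.apply, Ne.symm hab, Ne.symm ha10, h10]
  · refine ⟨⟨fun r hr => ?_, rfl, rfl⟩, ?_⟩
    · simp only [List.mem_cons, List.not_mem_nil, or_false, not_or] at hr
      simp [Instr.apply, Function.update_apply, hr]
    · simp [Instr.apply, Function.update_apply, ha50]
  · rintro j hj s' ⟨hf, hv⟩ hcnt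
    have hc' : s'.reg c = s.reg c := hf.reg c (by simp [hc, Ne.symm hac])
    have h11' : s'.reg 11 = 1 := (hf.reg 11 (by simp [Ne.symm ha11])).trans h11
    refine .step (.instr ⟨⟨⟨fun r hr => ?_, hf.mem, hf.asked⟩, ?_⟩, ?_⟩)
    · rw [← hf.reg r hr]
      simp only [List.mem_cons, List.not_mem_nil, or_false, not_or] at hr
      simp [Instr.apply, Function.update_apply, hr]
    · simp [Instr.apply, Function.update_apply, ha50, hv, hc', Nat.succ_mul]
    · simp [Instr.apply, Ne.symm ha50, hcnt, Ne.symm ha11, h11']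
      omega

/-- A program without effect on the cells used elsewhere. -/
def nop : Prog := .instr (.const 12 0)

/-- Cell `27` is divided by cell `20`; the remainder is put into cell `a`. -/
def divProg (a : ℕ) : Prog :=
  .seq (.instr (.const 37 0)) <| .seq (.instr (.const 38 0)) <| .seq (.instr (.add 39 27 10)) <|
  -- Division by counting up to the dividend: cell `37` is the running remainder, reset with a carry
  -- into cell `38` on reaching the divisor. The two `nop`s give both branches the same cost.
  .seq (.loop 39 <|
    .seq (.instr (.add 37 37 11)) <| .seq (.instr (.sub 40 20 37)) <|
    .seq (.ifZero 40 (.seq (.instr (.const 37 0)) (.instr (.add 38 38 11)))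
      (.seq nop nop)) (.instr (.sub 39 39 11))) <|
  .seq (.instr (.add a 37 10)) (.instr (.add 27 38 10))

lemma divProg_ends {s : State K n} (hs : Consts s) (hb : 0 < s.reg 20) (a : ℕ)
    (ha : a ∉ [10, 27, 38]) :
    Ends E (divProg a) s (7 * s.reg 27 + 6) fun s' =>
      Frame [a, 12, 27, 37, 38, 39, 40] s s' ∧ s'.reg a = s.reg 27 % s.reg 20 ∧
        s'.reg 27 = s.reg 27 / s.reg 20 := by
  simp only [List.mem_cons, List.not_mem_nil, or_false, not_or] at ha
  obtain ⟨ha10, ha27, ha38⟩ := ha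
  have hl : ([12, 37, 38, 39, 40] : List ℕ) ⊆ [a, 12, 27, 37, 38, 39, 40] := by
    intro r hr
    simp only [List.mem_cons, List.not_mem_nil, or_false] at hr ⊢
    omega
  obtain ⟨h10, h11⟩ := hs
  have hloop : ∀ s₁ : State K n, Frame [12, 37, 38, 39, 40] s s₁ → s₁.reg 37 = 0 →
      s₁.reg 38 = 0 → s₁.reg 39 = s.reg 27 → Ends E (.loop 39 <|
    .seq (.instr (.add 37 37 11)) <| .seq (.instr (.sub 40 20 37)) <|
    .seq (.ifZero 40 (.seq (.instr (.const 37 0)) (.instr (.add 38 38 11)))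
      (.seq nop nop)) (.instr (.sub 39 39 11))) s₁ (s.reg 27 * 7 + 1) fun s' =>
        Frame [12, 37, 38, 39, 40] s s' ∧ s'.reg 37 < s.reg 20 ∧
          s.reg 20 * s'.reg 38 + s'.reg 37 = s.reg 27 := by
    intro s₁ hf1 h37 h38 h39
    refine .countdown (fun j s' => Frame [12, 37, 38, 39, 40] s s' ∧ s'.reg 37 < s.reg 20 ∧
      s.reg 20 * s'.reg 38 + s'.reg 37 = j) (s.reg 27) 6 h39 ⟨hf1, by omega, by simp [h37, h38]⟩ ?_
    rintro j hj s' ⟨hf, hlt, heq⟩ hcnt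
    have h11' : s'.reg 11 = 1 := (hf.reg 11 (by simp)).trans h11
    have h20' : s'.reg 20 = s.reg 20 := hf.reg 20 (by simp)
    refine .step (.step (.seq (T := 3) (T' := 1) (Q := fun s'' =>
      Frame [12, 37, 38, 39, 40] s s'' ∧ (s''.reg 37 < s.reg 20 ∧
      s.reg 20 * s''.reg 38 + s''.reg 37 = j + 1) ∧ s''.reg 39 = s'.reg 39)
      (.ifZero (fun h0 => ?_) fun h0 => ?_) ?_))
    · refine .step (.instr ⟨⟨fun r hr => ?_, hf.mem, hf.asked⟩, ?_, ?_⟩)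
      · rw [← hf.reg r hr]
        simp only [List.mem_cons, List.not_mem_nil, or_false, not_or] at hr
        simp [Instr.apply, hr]
      · simp [Instr.apply, h11', h20'] at h0 ⊢
        refine ⟨hb, ?_⟩
        rw [mul_add]
        omega
      · simp [Instr.apply]
    · refine .step (.instr ⟨⟨fun r hr => ?_, hf.mem, hf.asked⟩, ?_, ?_⟩)
      · rw [← hf.reg r hr]
        simp only [List.mem_cons, List.not_mem_nil, or_false, not_or] at hr
        simp [Instr.apply, hr]
      · simp [Instr.apply, h11', h20'] at h0 ⊢
        omega
      · simp [Instr.apply]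
    · rintro s'' ⟨hf', h', h39'⟩
      have h11'' : s''.reg 11 = 1 := (hf'.reg 11 (by simp)).trans h11
      refine .instr ⟨⟨⟨fun r hr => ?_, hf'.mem, hf'.asked⟩, ?_⟩, ?_⟩
      · rw [← hf'.reg r hr]
        simp only [List.mem_cons, List.not_mem_nil, or_false, not_or] at hr
        simp [Instr.apply, hr]
      · simpa [Instr.apply, Function.update_apply] using h'
      · simp [Instr.apply, h11'', h39', hcnt]
        omega
  refine Ends.le (.step (.step (.step (.seq (hloop _ ⟨fun r hr => ?_, rfl, rfl⟩ ?_ ?_ ?_)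
    fun s' h => .step (.instr ?_))))) (by omega)
  · simp only [List.mem_cons, List.not_mem_nil, or_false, not_or] at hr
    simp [Instr.apply, hr]
  · simp [Instr.apply]
  · simp [Instr.apply]
  · simp [Instr.apply, h10]
  · obtain ⟨hf, hlt, heq⟩ := h
    have h10' : s'.reg 10 = 0 := (hf.reg 10 (by simp)).trans h10
    have hdiv := (Nat.div_mod_unique hb).2 ⟨(add_comm _ _).trans heq, hlt⟩
    refine ⟨⟨fun r hr => ?_, hf.mem, hf.asked⟩, ?_, ?_⟩
    · rw [← hf.reg r fun h => hr (hl h)]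
      simp only [List.mem_cons, List.not_mem_nil, or_false, not_or] at hr
      simp [Instr.apply, Function.update_apply, hr]
    · simp [Instr.apply, Function.update_apply, ha27, h10', hdiv.2]
    · simp [Instr.apply, Ne.symm ha10, Ne.symm ha38, h10', hdiv.1]

end BlackBoxRAM

/-! ### Computing and querying one point. -/

namespace BlackBoxRAM

open BasisIsolation

section OuterFrame

variable {K : Type*} {n : ℕ}

/-- The states differ at most in the number cells of the list `l` and in the first `16` cells for
field elements. -/
structure OuterFrame (l : List ℕ) (s s' : State K n) : Prop where
  reg : ∀ r, r ∉ l → s'.reg r = s.reg r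
  mem : ∀ m, 16 ≤ m → s'.mem m = s.mem m
  asked : s'.asked = s.asked

lemma Frame.outer {l : List ℕ} {s s' : State K n} (h : Frame l s s') : OuterFrame l s s' :=
  ⟨h.reg, fun m _ => congrFun h.mem m, h.asked⟩

lemma OuterFrame.trans {l l' l'' : List ℕ} {s s' s'' : State K n} (h : OuterFrame l s s')
    (h' : OuterFrame l' s' s'') (hl : l ⊆ l'') (hl' : l' ⊆ l'') : OuterFrame l'' s s'' where
  reg := fun r hr => (h'.reg r fun hm => hr (hl' hm)).trans (h.reg r fun hm => hr (hl hm))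
  mem := fun m hm => (h'.mem m hm).trans (h.mem m hm)
  asked := h'.asked.trans h.asked

lemma Consts.outer {l : List ℕ} {s s' : State K n} (h : Consts s) (hf : OuterFrame l s s')
    (h10 : 10 ∉ l) (h11 : 11 ∉ l) : Consts s' :=
  ⟨(hf.reg 10 h10).trans h.1, (hf.reg 11 h11).trans h.2⟩

end OuterFrame

variable {K : Type*} [Field K] {n : ℕ} {E : Env K n}

/-- Cell `34` becomes the product of cells `29` and `32` modulo cell `42`. -/
def mulModProg : Prog :=
  .seq (.instr (.const 34 0)) <| .seq (.instr (.add 35 29 10)) <| .loop 35 <|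
    -- Cell `41` is the modulus minus one, so the truncated difference is zero exactly when no
    -- reduction is due. Both summands are reduced, so one subtraction is enough.
    .seq (.instr (.add 34 34 32)) <| .seq (.instr (.sub 36 34 41)) <|
    .seq (.ifZero 36 nop (.instr (.sub 34 34 42))) (.instr (.sub 35 35 11))

lemma mulModProg_ends {s : State K n} (hs : Consts s) (h42 : s.reg 42 = s.reg 41 + 1)
    (hv : s.reg 32 < s.reg 42) :
    Ends E mulModProg s (6 * s.reg 29 + 3) fun s' =>
      Frame [12, 34, 35, 36] s s' ∧ s'.reg 34 = s.reg 29 * s.reg 32 % s.reg 42 := by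
  obtain ⟨h10, h11⟩ := hs
  refine Ends.le (.step (.step (.countdown (fun j s' => Frame [12, 34, 35, 36] s s' ∧
    s'.reg 34 = j * s.reg 32 % s.reg 42) (s.reg 29) 5 ?_ ?_ ?_))) (by omega)
  · simp [Instr.apply, h10]
  · refine ⟨⟨fun r hr => ?_, rfl, rfl⟩, ?_⟩
    · simp only [List.mem_cons, List.not_mem_nil, or_false, not_or] at hr
      simp [Instr.apply, hr]
    · simp [Instr.apply]
  · rintro j hj s' ⟨hf, hval⟩ hcnt
    have h11' : s'.reg 11 = 1 := (hf.reg 11 (by simp)).trans h11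
    have h32 : s'.reg 32 = s.reg 32 := hf.reg 32 (by simp)
    have h41 : s'.reg 41 = s.reg 41 := hf.reg 41 (by simp)
    have h42' : s'.reg 42 = s.reg 42 := hf.reg 42 (by simp)
    have hlt : s'.reg 34 < s.reg 42 := hval ▸ Nat.mod_lt _ (by omega)
    have hmod : (j + 1) * s.reg 32 % s.reg 42 = (s'.reg 34 + s.reg 32) % s.reg 42 := by
      rw [hval, Nat.mod_add_mod, Nat.succ_mul]
    refine .step (.step (.seq (T := 2) (T' := 1) (Q := fun s'' => Frame [12, 34, 35, 36] s s'' ∧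
      s''.reg 34 = (j + 1) * s.reg 32 % s.reg 42 ∧ s''.reg 35 = s'.reg 35)
      (.ifZero (fun h0 => ?_) fun h0 => ?_) ?_))
    · refine .instr ⟨⟨fun r hr => ?_, hf.mem, hf.asked⟩, ?_, ?_⟩
      · rw [← hf.reg r hr]
        simp only [List.mem_cons, List.not_mem_nil, or_false, not_or] at hr
        simp [Instr.apply, hr]
      · simp only [Instr.apply, Function.update_apply] at h0 ⊢
        simp [h32, h41] at h0 ⊢
        rw [hmod, Nat.mod_eq_of_lt (by omega)]
      · simp [Instr.apply]
    · refine .instr ⟨⟨fun r hr => ?_, hf.mem, hf.asked⟩, ?_, ?_⟩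
      · rw [← hf.reg r hr]
        simp only [List.mem_cons, List.not_mem_nil, or_false, not_or] at hr
        simp [Instr.apply, hr]
      · simp only [Instr.apply, Function.update_apply] at h0 ⊢
        simp [h32, h41, h42'] at h0 ⊢
        rw [hmod, Nat.mod_eq_sub_mod (by omega), Nat.mod_eq_of_lt (by omega)]
      · simp [Instr.apply]
    · rintro s'' ⟨hf', hval', hcnt'⟩
      have h11'' : s''.reg 11 = 1 := (hf'.reg 11 (by simp)).trans h11
      refine .instr ⟨⟨⟨fun r hr => ?_, hf'.mem, hf'.asked⟩, ?_⟩, ?_⟩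
      · rw [← hf'.reg r hr]
        simp only [List.mem_cons, List.not_mem_nil, or_false, not_or] at hr
        simp [Instr.apply, hr]
      · simpa [Instr.apply] using hval'
      · simp [Instr.apply, h11'', hcnt', hcnt]
        omega

/-- With `c`, `p`, `i` in the cells `29`, `30`, `25`, cell `32` becomes `c ^ i` modulo `p + 2`. -/
def powModProg : Prog :=
  .seq (.instr (.add 41 30 11)) <| .seq (.instr (.add 42 41 11)) <| .seq (.instr (.const 32 1)) <|
  .seq (.instr (.add 33 25 10)) <| .loop 33 <|
    .seq mulModProg <| .seq (.instr (.add 32 34 10)) (.instr (.sub 33 33 11))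

lemma powModProg_ends {s : State K n} (hs : Consts s) :
    Ends E powModProg s (s.reg 25 * (6 * s.reg 29 + 6) + 5) fun s' =>
      Frame [12, 32, 33, 34, 35, 36, 41, 42] s s' ∧
        s'.reg 32 = s.reg 29 ^ s.reg 25 % (s.reg 30 + 2) := by
  have h10 := hs.1
  have h11 := hs.2
  refine Ends.le (.step (.step (.step (.step (.imp (.countdown
    (fun j s' => Frame [12, 32, 33, 34, 35, 36, 41, 42] s s' ∧ s'.reg 41 = s.reg 30 + 1 ∧
      s'.reg 42 = s.reg 30 + 2 ∧ s'.reg 32 = s.reg 29 ^ j % (s.reg 30 + 2))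
      (s.reg 25) (6 * s.reg 29 + 5) ?_ ?_ ?_) fun s' h => ⟨h.1, h.2.2.2⟩))))) (le_of_eq (by ring))
  · simp [Instr.apply, h10]
  · refine ⟨⟨fun r hr => ?_, rfl, rfl⟩, ?_, ?_, ?_⟩
    · simp only [List.mem_cons, List.not_mem_nil, or_false, not_or] at hr
      simp [Instr.apply, hr]
    · simp [Instr.apply, h11]
    · simp [Instr.apply, h11]
    · simp [Instr.apply]
  · rintro j hj s' ⟨hf, h41, h42, h32⟩ hcnt
    have hs' : Consts s' := hs.frame hf (by simp) (by simp)
    have h29 : s'.reg 29 = s.reg 29 := hf.reg 29 (by simp)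
    refine Ends.le (.seq (mulModProg_ends hs' (by omega)
      (by rw [h32, h42]; exact Nat.mod_lt _ (by omega))) fun s'' h => .step (.instr ?_))
      (by rw [h29])
    obtain ⟨hf', h34⟩ := h
    have hs'' := hs'.frame hf' (by simp) (by simp)
    have hff := hf.trans hf' (l'' := [12, 32, 33, 34, 35, 36, 41, 42]) (by simp) (by simp)
    refine ⟨⟨⟨fun r hr => ?_, hff.mem, hff.asked⟩, ?_, ?_, ?_⟩, ?_⟩
    · rw [← hff.reg r hr]
      simp only [List.mem_cons, List.not_mem_nil, or_false, not_or] at hr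
      simp [Instr.apply, hr]
    · simp [Instr.apply, hf'.reg 41, h41]
    · simp [Instr.apply, hf'.reg 42, h42]
    · simp [Instr.apply, hs''.1, h34, h29, h32, h42, pow_succ']
    · simp [Instr.apply, hs''.2, hf'.reg 33, hcnt]
      omega

/-- One level: three digits of cell `27` are split off, and cell `0` for field elements is
multiplied by the corresponding power. -/
def levelProg : Prog :=
  .seq (divProg 29) <| .seq (divProg 30) <| .seq (divProg 31) <| .seq powModProg <|
  .seq (.instr (.sample 2 31)) <|
  .seq (.loop 32 (.seq (.instr (.fmul 0 0 2)) (.instr (.sub 32 32 11)))) (.instr (.sub 28 28 11))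

/-- The cells that `levelProg` may change, apart from the counter. -/
def levelCells : List ℕ := [12, 27, 29, 30, 31, 32, 33, 34, 35, 36, 37, 38, 39, 40, 41, 42]

lemma levelProg_ends {s : State K n} (hs : Consts s) {b q i U : ℕ} (hb0 : 0 < b)
    (hb : s.reg 20 = b) (hq : s.reg 27 = q) (hi : s.reg 25 = i) (hbU : b ≤ U) (hqU : q ≤ U)
    (hiU : i ≤ U) :
    Ends E levelProg s (6 * U ^ 2 + 30 * U + 26) fun s' =>
      OuterFrame (28 :: levelCells) s s' ∧ s'.reg 28 = s.reg 28 - 1 ∧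
        s'.reg 27 = q / b / b / b ∧
        s'.mem 0 = s.mem 0 * E.sample (q / b / b % b) ^ ((q % b) ^ i % (q / b % b + 2)) := by
  have hdiv : ∀ (a : ℕ) (s₁ : State K n) (q' : ℕ), a ∈ [29, 30, 31] → Frame levelCells s s₁ →
      s₁.reg 27 = q' → q' ≤ U → Ends E (divProg a) s₁ (7 * U + 6) fun s' =>
        Frame levelCells s s' ∧ s'.reg a = q' % b ∧ s'.reg 27 = q' / b ∧
          ∀ r ∈ [29, 30, 31], r ≠ a → s'.reg r = s₁.reg r := by
    intro a s₁ q' ha hf h27 hq'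
    have hb1 : s₁.reg 20 = b := (hf.reg 20 (by simp [levelCells])).trans hb
    have ha' : a = 29 ∨ a = 30 ∨ a = 31 := by simpa using ha
    refine Ends.le (.imp (divProg_ends (hs.frame hf (by simp [levelCells]) (by simp [levelCells]))
      (by omega) a (by simp; omega)) fun s' h => ?_) (by rw [h27]; omega)
    obtain ⟨hf', hr, hq⟩ := h
    refine ⟨hf.trans hf' (List.Subset.refl _) ?_, by rw [hr, h27, hb1], by rw [hq, h27, hb1], ?_⟩
    · rcases ha' with rfl | rfl | rfl <;> simp [levelCells]
    · intro r hr hra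
      refine hf'.reg r ?_
      simp only [List.mem_cons, List.not_mem_nil, or_false] at hr ⊢
      omega
  have hT : (7 * U + 6) + ((7 * U + 6) + ((7 * U + 6) + ((U * (6 * U + 6) + 5) +
      ((b * 3 + 1) + 1 + 1)))) ≤ 6 * U ^ 2 + 30 * U + 26 := by nlinarith
  refine Ends.le (.seq (hdiv 29 s q (by simp) (Frame.refl _ _) hq hqU) fun s₁ h₁ => ?_) hT
  obtain ⟨hf1, hc1, hq1, -⟩ := h₁
  refine .seq (hdiv 30 s₁ _ (by simp) hf1 hq1 ((Nat.div_le_self _ _).trans hqU)) fun s₂ h₂ => ?_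
  obtain ⟨hf2, hp2, hq2, hr2⟩ := h₂
  refine .seq (hdiv 31 s₂ _ (by simp) hf2 hq2 ((Nat.div_le_self _ _).trans
    ((Nat.div_le_self _ _).trans hqU))) fun s₃ h₃ => ?_
  obtain ⟨hf3, hs3, hq3, hr3⟩ := h₃
  have hc3 : s₃.reg 29 = q % b := by
    rw [hr3 29 (by simp) (by simp), hr2 29 (by simp) (by simp), hc1]
  have hp3 : s₃.reg 30 = q / b % b := by rw [hr3 30 (by simp) (by simp), hp2]
  have hi3 : s₃.reg 25 = i := (hf3.reg 25 (by simp [levelCells])).trans hi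
  have hcs3 : Consts s₃ := hs.frame hf3 (by simp [levelCells]) (by simp [levelCells])
  have hcU : q % b ≤ U := (Nat.mod_le _ _).trans hqU
  refine .seq (Ends.le (powModProg_ends hcs3) ?_) fun s₄ h₄ => ?_
  · rw [hi3, hc3]
    gcongr
  obtain ⟨hf4, hv4⟩ := h₄
  have hv : s₄.reg 32 = (q % b) ^ i % (q / b % b + 2) := by rw [hv4, hc3, hp3, hi3]
  -- The modulus is at most `b + 1`; this bounds the number of field multiplications.
  have hvb : s₄.reg 32 ≤ b := by
    have h1 : (q % b) ^ i % (q / b % b + 2) < q / b % b + 2 := Nat.mod_lt _ (by omega)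
    have h2 := Nat.mod_lt (q / b) hb0
    omega
  have hs4 : s₄.reg 31 = q / b / b % b := (hf4.reg 31 (by simp)).trans hs3
  have hq4 : s₄.reg 27 = q / b / b / b := (hf4.reg 27 (by simp)).trans hq3
  have hcs4 : Consts s₄ := hcs3.frame hf4 (by simp) (by simp)
  have hF : Frame levelCells s s₄ := hf3.trans hf4 (List.Subset.refl _) (by simp [levelCells])
  refine .step (.seq (T := b * 3 + 1) (T' := 1) (Ends.le (.countdown (fun j s' => OuterFrame levelCells s s' ∧
    s'.reg 27 = q / b / b / b ∧ s'.mem 2 = E.sample (q / b / b % b) ∧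
    s'.mem 0 = s.mem 0 * E.sample (q / b / b % b) ^ j) (s₄.reg 32) 2 rfl ?_ ?_) (by omega))
    fun s' h => .instr ?_)
  · refine ⟨⟨hF.reg, fun m hm => ?_, hF.asked⟩, hq4, ?_, ?_⟩
    · simp [Instr.apply, show m ≠ 2 by omega, hF.mem]
    · simp [Instr.apply, hs4]
    · simp [Instr.apply, hF.mem]
  · rintro j hj s' ⟨hf, hq', h2, h0⟩ hcnt
    have hcs := hs.outer hf (by simp [levelCells]) (by simp [levelCells])
    refine .step (.instr ⟨⟨⟨fun r hr => ?_, fun m hm => ?_, hf.asked⟩, ?_, ?_, ?_⟩, ?_⟩)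
    · rw [← hf.reg r hr]
      simp only [levelCells, List.mem_cons, List.not_mem_nil, or_false, not_or] at hr
      simp [Instr.apply, hr]
    · simp [Instr.apply, show m ≠ 0 by omega, hf.mem m hm]
    · simp [Instr.apply, hq']
    · simp [Instr.apply, h2]
    · simp [Instr.apply, h2, h0, pow_succ, mul_assoc]
    · simp [Instr.apply, hcs.2, hcnt]
      omega
  · obtain ⟨hf, hq', -, h0⟩ := h
    have hcs := hs.outer hf (by simp [levelCells]) (by simp [levelCells])
    refine ⟨⟨fun r hr => ?_, hf.mem, hf.asked⟩, ?_, ?_, ?_⟩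
    · rw [List.mem_cons, not_or] at hr
      rw [← hf.reg r hr.2]
      simp [Instr.apply, hr.1]
    · simp [Instr.apply, hcs.2, hf.reg 28 (by simp [levelCells])]
    · simp [Instr.apply, hq']
    · simp [Instr.apply, h0, hv]

/-- One coordinate, whose index is in cell `25`, of the point encoded by cell `22`. -/
def coordProg : Prog :=
  .seq (.instr (.fone 0)) <| .seq (.instr (.add 27 22 10)) <| .seq (.instr (.add 28 21 10)) <|
  .seq (.loop 28 levelProg) <| .seq (.instr (.add 36 24 25)) <| .seq (.instr (.fstore 36 0)) <|
  .seq (.instr (.add 25 25 11)) (.instr (.sub 26 26 11))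

/-- Coordinates are stored from field cell `16` on, beyond the scratch cells that a level may
change, so earlier coordinates survive. -/
lemma coordProg_ends {s : State K n} (hs : Consts s) {b z i m U : ℕ} (hb0 : 0 < b)
    (hb : s.reg 20 = b) (hm : s.reg 21 = m) (hz : s.reg 22 = z) (hi : s.reg 25 = i)
    (h24 : s.reg 24 = 16) (hbU : b ≤ U) (hzU : z ≤ U) (hiU : i ≤ U) :
    Ends E coordProg s (m * (6 * U ^ 2 + 30 * U + 27) + 8) fun s' =>
      (∀ r, r ∉ 25 :: 26 :: 28 :: levelCells → s'.reg r = s.reg r) ∧ s'.reg 25 = i + 1 ∧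
        s'.reg 26 = s.reg 26 - 1 ∧ s'.asked = s.asked ∧
        s'.mem (16 + i) = digitPoint E.sample b m z i ∧
        ∀ r, 16 ≤ r → r ≠ 16 + i → s'.mem r = s.mem r := by
  refine Ends.le (.step (.step (.step (.seq (.countdown (fun j s' =>
    OuterFrame (28 :: levelCells) s s' ∧ s'.reg 27 = z / b ^ (3 * j) ∧
      s'.mem 0 = digitPoint E.sample b j z i) m (6 * U ^ 2 + 30 * U + 26) ?_ ?_ ?_)
      fun s' h => .step (.step (.step (.instr ?_))))))) (le_of_eq (by ring))
  · simp [Instr.apply, hs.1, hm]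
  · refine ⟨⟨fun r hr => ?_, fun r hr => ?_, rfl⟩, ?_, ?_⟩
    · simp only [levelCells, List.mem_cons, List.not_mem_nil, or_false, not_or] at hr
      simp [Instr.apply, hr]
    · simp [Instr.apply, show r ≠ 0 by omega]
    · simp [Instr.apply, hs.1, hz]
    · simp [Instr.apply, digitPoint]
  · rintro j hj s' ⟨hf, h27, h0⟩ hcnt
    have hcs := hs.outer hf (by simp [levelCells]) (by simp [levelCells])
    refine Ends.imp (levelProg_ends hcs hb0 ((hf.reg 20 (by simp [levelCells])).trans hb) h27
      ((hf.reg 25 (by simp [levelCells])).trans hi) hbU ((Nat.div_le_self _ _).trans hzU) hiU)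
      fun s'' h => ?_
    obtain ⟨hf', h28', h27', h0'⟩ := h
    refine ⟨⟨hf.trans hf' (List.Subset.refl _) (List.Subset.refl _), ?_, ?_⟩, ?_⟩
    · rw [h27', Nat.div_div_eq_div_mul, Nat.div_div_eq_div_mul, Nat.div_div_eq_div_mul]
      congr 1
      ring
    · rw [h0', h0, digitPoint, digitPoint, Finset.prod_range_succ]
      simp only [Nat.div_div_eq_div_mul, pow_add, pow_two, pow_one, mul_assoc]
    · rw [h28', hcnt]
      omega
  · obtain ⟨hf, -, h0⟩ := h
    have hcs := hs.outer hf (by simp [levelCells]) (by simp [levelCells])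
    have h24' : s'.reg 24 = 16 := (hf.reg 24 (by simp [levelCells])).trans h24
    have hi' : s'.reg 25 = i := (hf.reg 25 (by simp [levelCells])).trans hi
    refine ⟨fun r hr => ?_, ?_, ?_, hf.asked, ?_, fun r hr hri => ?_⟩
    · rw [List.mem_cons, List.mem_cons, not_or, not_or] at hr
      rw [← hf.reg r hr.2.2]
      simp only [levelCells, List.mem_cons, List.not_mem_nil, or_false, not_or] at hr
      simp [Instr.apply, hr]
    · simp [Instr.apply, hi', hcs.2]
    · simp [Instr.apply, hcs.2, hf.reg 26 (by simp [levelCells])]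
    · simp [Instr.apply, h24', hi', h0]
    · simp [Instr.apply, h24', hi', hri, hf.mem r hr]

/-- The point encoded by cell `22` is computed and queried. -/
def pointProg : Prog :=
  .seq (.instr (.const 25 0)) <| .seq (.instr (.add 26 0 10)) <| .seq (.loop 26 coordProg) <|
  .seq (.instr (.query 1 24)) (.ifFieldZero 1 nop (.instr (.const 23 0)))

/-- The cells that `pointProg` may change. -/
def pointCells : List ℕ := 23 :: 25 :: 26 :: 28 :: levelCells

open Classical in
lemma pointProg_ends {s : State K n} (hs : Consts s) {b z m U : ℕ} (hb0 : 0 < b)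
    (h0 : s.reg 0 = n) (hb : s.reg 20 = b) (hm : s.reg 21 = m) (hz : s.reg 22 = z)
    (h24 : s.reg 24 = 16) (hbU : b ≤ U) (hzU : z ≤ U) (hnU : n ≤ U) :
    Ends E pointProg s (n * (m * (6 * U ^ 2 + 30 * U + 27) + 9) + 6) fun s' =>
      (∀ r, r ∉ pointCells → s'.reg r = s.reg r) ∧
        s'.asked = insert (fun i : Fin n => digitPoint E.sample b m z i) s.asked ∧
        s'.reg 23 = if E.box (fun i : Fin n => digitPoint E.sample b m z i) = 0
          then s.reg 23 else 0 := by
  refine Ends.le (.step (.step (.seq (.countdown (fun j s' =>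
    (∀ r, r ∉ 25 :: 26 :: 28 :: levelCells → s'.reg r = s.reg r) ∧ s'.reg 25 = j ∧
      s'.asked = s.asked ∧ ∀ i < j, s'.mem (16 + i) = digitPoint E.sample b m z i) n
      (m * (6 * U ^ 2 + 30 * U + 27) + 8) ?_ ?_ ?_) fun s' h => .step (T := 2) ?_)))
    (le_of_eq (by ring))
  · simp [Instr.apply, hs.1, h0]
  · refine ⟨fun r hr => ?_, ?_, rfl, fun i hi => absurd hi (by omega)⟩
    · simp only [levelCells, List.mem_cons, List.not_mem_nil, or_false, not_or] at hr
      simp [Instr.apply, hr]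
    · simp [Instr.apply]
  · rintro j hj s' ⟨hf, h25, hask, hmem⟩ hcnt
    have hcs : Consts s' :=
      ⟨(hf 10 (by simp [levelCells])).trans hs.1, (hf 11 (by simp [levelCells])).trans hs.2⟩
    refine Ends.imp (coordProg_ends hcs hb0 ((hf 20 (by simp [levelCells])).trans hb)
      ((hf 21 (by simp [levelCells])).trans hm) ((hf 22 (by simp [levelCells])).trans hz) h25
      ((hf 24 (by simp [levelCells])).trans h24) hbU hzU (by omega)) fun s'' h => ?_
    obtain ⟨hf', h25', h26', hask', hnew, hold⟩ := h
    refine ⟨⟨fun r hr => (hf' r hr).trans (hf r hr), h25', hask'.trans hask, fun i hi => ?_⟩, ?_⟩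
    · rcases Nat.lt_succ_iff_lt_or_eq.1 hi with hlt | rfl
      · rw [hold _ (by omega) (by omega), hmem i hlt]
      · exact hnew
    · rw [h26', hcnt]
      omega
  · obtain ⟨hf, -, hask, hmem⟩ := h
    have h24' : s'.reg 24 = 16 := (hf 24 (by simp [levelCells])).trans h24
    have h23' : s'.reg 23 = s.reg 23 := hf 23 (by simp [levelCells])
    have hpt : (fun i : Fin n => s'.mem (s'.reg 24 + i)) =
        fun i : Fin n => digitPoint E.sample b m z i := by
      funext i
      rw [h24', hmem i i.2]
    have hf' : ∀ r, r ∉ pointCells → s'.reg r = s.reg r :=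
      fun r hr => hf r fun h => hr (List.mem_cons_of_mem _ h)
    refine .ifFieldZero (fun hz0 => .instr ⟨fun r hr => ?_, ?_, ?_⟩)
      fun hz0 => .instr ⟨fun r hr => ?_, ?_, ?_⟩
    · rw [← hf' r hr]
      simp only [pointCells, levelCells, List.mem_cons, List.not_mem_nil, or_false, not_or] at hr
      simp [Instr.apply, hr]
    · simp [Instr.apply, hpt, hask]
    · simp only [Instr.apply, hpt, Function.update_self] at hz0
      simp [Instr.apply, hz0, h23']
    · rw [← hf' r hr]
      simp only [pointCells, levelCells, List.mem_cons, List.not_mem_nil, or_false, not_or] at hr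
      simp [Instr.apply, hr]
    · simp [Instr.apply, hpt, hask]
    · simp only [Instr.apply, hpt, Function.update_self] at hz0
      simp [Instr.apply, hz0]

end BlackBoxRAM

/-! ### Parameters, enumeration of the points, and the complete test. -/

namespace BlackBoxRAM

open BasisIsolation

variable {K : Type*} [Field K] {n : ℕ} {E : Env K n}

/-- A form made for chaining: the frame refers to a fixed earlier state, the untouched cells to the
state just before. -/
lemma mulProg_ends_of_frame {s s₁ : State K n} {l : List ℕ} (hs : Consts s) (hf : Frame l s s₁)
    (h10 : 10 ∉ l) (h11 : 11 ∉ l) {a b c : ℕ} (ha : a ∈ l) (h50 : 50 ∈ l) (ha50 : a ≠ 50)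
    (hab : a ≠ b) (hac : a ≠ c) (hc : c ≠ 50) {x y U : ℕ} (hx : s₁.reg b = x) (hy : s₁.reg c = y)
    (hU : x ≤ U) :
    Ends E (mulProg a b c) s₁ (3 * U + 3) fun s' =>
      Frame l s s' ∧ s'.reg a = x * y ∧ ∀ r, r ≠ a → r ≠ 50 → s'.reg r = s₁.reg r := by
  have ha' : a ∉ [10, 11, 50] := by
    simp only [List.mem_cons, List.not_mem_nil, or_false, not_or]
    exact ⟨fun h => h10 (h ▸ ha), fun h => h11 (h ▸ ha), ha50⟩
  refine Ends.le (.imp (mulProg_ends (hs.frame hf h10 h11) a b c hab hac ha' hc) fun s' h => ?_)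
    (by omega)
  obtain ⟨hf', hv⟩ := h
  refine ⟨hf.trans hf' (List.Subset.refl _) (by simp [ha, h50]), by rw [hv, hx, hy], ?_⟩
  exact fun r hra hr => hf'.reg r (by simp [hra, hr])

/-- With `n`, `k`, `w`, `d` in the first four cells, cell `46` becomes `n k d w ^ (2 k)`. -/
def sizeProg : Prog :=
  .seq (.instr (.const 45 1)) <| .seq (.instr (.add 46 1 1)) <|
  .seq (.loop 46 <| .seq (mulProg 47 45 2) <|
    .seq (.instr (.add 45 47 10)) (.instr (.sub 46 46 11))) <|
  .seq (mulProg 46 0 1) <| .seq (mulProg 47 46 3) (mulProg 46 47 45)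

lemma sizeProg_ends {s : State K n} (hs : Consts s) {m k w d U : ℕ} (hm : s.reg 0 = m)
    (hk : s.reg 1 = k) (hw : s.reg 2 = w) (hd : s.reg 3 = d) (hw0 : 0 < w)
    (hrU : w ^ (2 * k) ≤ U) (hmU : m ≤ U) (hmkU : m * k ≤ U) (hmkdU : m * k * d ≤ U) :
    Ends E sizeProg s (2 * k * (3 * U + 6) + 9 * U + 12) fun s' =>
      Frame [20, 45, 46, 47, 50] s s' ∧ s'.reg 46 = sizeParam m k w d := by
  have hT : (2 * k * (3 * U + 5 + 1) + 1) + ((3 * U + 3) + ((3 * U + 3) + (3 * U + 3))) + 1 + 1 ≤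
      2 * k * (3 * U + 6) + 9 * U + 12 := by
    have : 2 * k * (3 * U + 5 + 1) = 2 * k * (3 * U + 6) := by ring
    omega
  refine Ends.le (.step (.step (.seq (T := 2 * k * (3 * U + 5 + 1) + 1)
    (T' := (3 * U + 3) + ((3 * U + 3) + (3 * U + 3))) (.countdown (fun j s' =>
    Frame [20, 45, 46, 47, 50] s s' ∧ s'.reg 45 = w ^ j) (2 * k) (3 * U + 5) ?_ ?_ ?_)
    fun s₁ h₁ => ?_))) hT
  · simp [Instr.apply, hk, two_mul]
  · refine ⟨⟨fun r hr => ?_, rfl, rfl⟩, ?_⟩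
    · simp only [List.mem_cons, List.not_mem_nil, or_false, not_or] at hr
      simp [Instr.apply, hr]
    · simp [Instr.apply]
  · rintro j hj s' ⟨hf, h45⟩ hcnt
    refine .seq (T := 3 * U + 3) (T' := 2) (mulProg_ends_of_frame (U := U) hs hf (by simp) (by simp)
      (by simp) (by simp) (by simp) (by simp) (by simp) (by simp) h45
      ((hf.reg 2 (by simp)).trans hw) ((Nat.pow_le_pow_right hw0 hj.le).trans hrU))
      fun s'' h => .step (.instr ?_)
    obtain ⟨hf', h47, hr⟩ := h
    have hcs := hs.frame hf' (by simp) (by simp)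
    refine ⟨⟨⟨fun r hr => ?_, hf'.mem, hf'.asked⟩, ?_⟩, ?_⟩
    · rw [← hf'.reg r hr]
      simp only [List.mem_cons, List.not_mem_nil, or_false, not_or] at hr
      simp [Instr.apply, hr]
    · simp [Instr.apply, h47, hcs.1, pow_succ]
    · simp [Instr.apply, hr, hcnt, (hf.reg 11 (by simp)).trans hs.2]
      omega
  · obtain ⟨hf1, h45⟩ := h₁
    refine .seq (mulProg_ends_of_frame hs hf1 (by simp) (by simp) (by simp) (by simp) (by simp)
      (by simp) (by simp) (by simp) ((hf1.reg 0 (by simp)).trans hm)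
      ((hf1.reg 1 (by simp)).trans hk) hmU) fun s₂ h₂ => ?_
    obtain ⟨hf2, h46, hr2⟩ := h₂
    refine .seq (mulProg_ends_of_frame hs hf2 (by simp) (by simp) (by simp) (by simp) (by simp)
      (by simp) (by simp) (by simp) h46 ((hf2.reg 3 (by simp)).trans hd) hmkU) fun s₃ h₃ => ?_
    obtain ⟨hf3, h47, hr3⟩ := h₃
    refine Ends.imp (mulProg_ends_of_frame hs hf3 (by simp) (by simp) (by simp) (by simp) (by simp)
      (by simp) (by simp) (by simp) h47 (y := w ^ (2 * k))
      (by rw [hr3 45 (by simp) (by simp), hr2 45 (by simp) (by simp), h45]) hmkdU) fun s₄ h₄ => ?_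
    exact ⟨h₄.1, h₄.2.1⟩

/-- Cell `20` becomes the power `T ^ 16` of the number `T` in cell `46`, and cell `45` becomes
the third power of that. -/
def baseProg : Prog :=
  -- Four squarings reach `T ^ 16`; two more products give `T ^ 32` and `T ^ 48`, the number of
  -- digit triples of one level.
  .seq (mulProg 47 46 46) <| .seq (mulProg 46 47 47) <| .seq (mulProg 47 46 46) <|
  .seq (mulProg 20 47 47) <| .seq (mulProg 46 20 20) (mulProg 45 46 20)

lemma baseProg_ends {s : State K n} (hs : Consts s) {T U : ℕ} (hT : s.reg 46 = T) (hT0 : 0 < T)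
    (hU : (T ^ 16) ^ 2 ≤ U) :
    Ends E baseProg s (18 * U + 18) fun s' => Frame [20, 45, 46, 47, 50] s s' ∧
      s'.reg 20 = T ^ 16 ∧ s'.reg 45 = (T ^ 16) ^ 3 := by
  have hle : ∀ i ≤ 32, T ^ i ≤ U := fun i hi =>
    (Nat.pow_le_pow_right hT0 hi).trans ((pow_mul T 16 2).le.trans hU)
  refine Ends.le (.seq (mulProg_ends_of_frame (U := U) hs (Frame.refl [20, 45, 46, 47, 50] s)
    (by simp) (by simp) (by simp) (by simp) (by simp) (by simp) (by simp) (by simp)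
    hT hT ((pow_one T).ge.trans (hle 1 (by norm_num)))) (T' := 5 * (3 * U + 3))
    fun s₁ h₁ => ?_) (by omega)
  obtain ⟨hf1, h1, -⟩ := h₁
  refine Ends.le (.seq (mulProg_ends_of_frame (U := U) hs hf1 (by simp) (by simp) (by simp)
    (by simp) (by simp) (by simp) (by simp) (by simp) h1 h1
    ((by ring : T * T = T ^ 2).le.trans (hle 2 (by norm_num)))) (T' := 4 * (3 * U + 3))
    fun s₂ h₂ => ?_) (by omega)
  obtain ⟨hf2, h2, -⟩ := h₂
  refine Ends.le (.seq (mulProg_ends_of_frame (U := U) hs hf2 (by simp) (by simp) (by simp)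
    (by simp) (by simp) (by simp) (by simp) (by simp) h2 h2
    ((by ring : T * T * (T * T) = T ^ 4).le.trans (hle 4 (by norm_num)))) (T' := 3 * (3 * U + 3))
    fun s₃ h₃ => ?_) (by omega)
  obtain ⟨hf3, h3, -⟩ := h₃
  refine Ends.le (.seq (mulProg_ends_of_frame (U := U) hs hf3 (by simp) (by simp) (by simp)
    (by simp) (by simp) (by simp) (by simp) (by simp) h3 h3
    ((by ring : T * T * (T * T) * (T * T * (T * T)) = T ^ 8).le.trans (hle 8 (by norm_num))))
    (T' := 2 * (3 * U + 3)) fun s₄ h₄ => ?_) (by omega)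
  obtain ⟨hf4, h4, -⟩ := h₄
  have h4' : s₄.reg 20 = T ^ 16 := by rw [h4]; ring
  refine Ends.le (.seq (mulProg_ends_of_frame (U := U) hs hf4 (by simp) (by simp) (by simp)
    (by simp) (by simp) (by simp) (by simp) (by simp) h4' h4' (hle 16 (by norm_num)))
    (T' := 3 * U + 3) fun s₅ h₅ => ?_) (by omega)
  obtain ⟨hf5, h5, hr5⟩ := h₅
  refine Ends.imp (mulProg_ends_of_frame (U := U) hs hf5 (by simp) (by simp) (by simp)
    (by simp) (by simp) (by simp) (by simp) (by simp) h5
    ((hr5 20 (by simp) (by simp)).trans h4') ((pow_two _).ge.trans hU)) fun s₆ h₆ => ?_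
  obtain ⟨hf6, h6, hr6⟩ := h₆
  refine ⟨hf6, ?_, by rw [h6]; ring⟩
  rw [hr6 20 (by simp) (by simp), hr5 20 (by simp) (by simp), h4']

/-- With `m` in cell `0` and `x` in cell `45`, cell `21` becomes the number `⌈log₂ m⌉ + 1` of
levels and cell `22` the corresponding power of `x`. -/
def rangeProg : Prog :=
  .seq (.instr (.const 21 1)) <| .seq (.instr (.add 22 45 10)) <| .seq (.instr (.const 47 1)) <|
  .seq (.instr (.sub 48 0 47)) <| .loop 48 <|
    .seq (.instr (.add 47 47 47)) <| .seq (.instr (.add 21 21 11)) <| .seq (mulProg 46 22 45) <|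
    .seq (.instr (.add 22 46 10)) (.instr (.sub 48 0 47))

lemma rangeProg_ends {s : State K n} (hs : Consts s) {m x U : ℕ} (hm : s.reg 0 = m)
    (hx : s.reg 45 = x) (hx0 : 0 < x) (hU : x ^ (Nat.clog 2 m + 1) ≤ U) :
    Ends E rangeProg s (Nat.clog 2 m * (3 * U + 8) + 5) fun s' =>
      Frame [21, 22, 46, 47, 48, 50] s s' ∧ s'.reg 21 = Nat.clog 2 m + 1 ∧
        s'.reg 22 = x ^ (Nat.clog 2 m + 1) := by
  have hT : Nat.clog 2 m * (3 * U + 7 + 1) + 1 + 1 + 1 + 1 + 1 ≤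
      Nat.clog 2 m * (3 * U + 8) + 5 := le_of_eq (by ring)
  -- The loop test is the truncated difference `m - 2 ^ j`, which first vanishes at `j = Nat.clog 2
  -- m`.
  have hcl : ∀ j, m - 2 ^ j = 0 ↔ Nat.clog 2 m ≤ j := fun j => by
    rw [Nat.sub_eq_zero_iff_le, Nat.clog_le_iff_le_pow (by norm_num)]
  refine Ends.le (.step (.step (.step (.step (.imp (.loop (fun j s' =>
    Frame [21, 22, 46, 47, 48, 50] s s' ∧ s'.reg 21 = j + 1 ∧ s'.reg 22 = x ^ (j + 1) ∧
      s'.reg 47 = 2 ^ j ∧ s'.reg 48 = m - 2 ^ j) (Nat.clog 2 m) (3 * U + 7) ?_ ?_ ?_)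
      fun s' h => ⟨h.1, h.2.1, h.2.2.1⟩))))) hT
  · refine ⟨⟨fun r hr => ?_, rfl, rfl⟩, ?_, ?_, ?_, ?_⟩
    · simp only [List.mem_cons, List.not_mem_nil, or_false, not_or] at hr
      simp [Instr.apply, hr]
    · simp [Instr.apply]
    · simp [Instr.apply, hx, hs.1]
    · simp [Instr.apply]
    · simp [Instr.apply, hm]
  · rintro j hj s' ⟨hf, h21, h22, h47, h48⟩
    refine ⟨fun h => ?_, .step (.step (.seq (T := 3 * U + 3) (T' := 2)
      (mulProg_ends_of_frame (l := [21, 22, 46, 47, 48, 50]) (a := 46) (b := 22) (c := 45)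
        (s₁ := Instr.apply E (Instr.apply E s' (.add 47 47 47)) (.add 21 21 11)) (x := x ^ (j + 1)) (y := x) (U := U)
        hs ⟨fun r hr => ?_, hf.mem, hf.asked⟩ (by simp) (by simp) (by simp) (by simp) (by simp)
        (by simp) (by simp) (by simp) ?_ ?_
        ((Nat.pow_le_pow_right hx0 (by omega)).trans hU)) fun s'' h => .step (.instr ?_)))⟩
    · have := (hcl j).1 (h48 ▸ h)
      omega
    · rw [← hf.reg r hr]
      simp only [List.mem_cons, List.not_mem_nil, or_false, not_or] at hr
      simp [Instr.apply, hr]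
    · simp [Instr.apply, h22]
    · simp [Instr.apply, hf.reg 45, hx]
    · obtain ⟨hf', h46, hr⟩ := h
      have hcs := hs.frame hf (by simp) (by simp)
      have hcs' := hs.frame hf' (by simp) (by simp)
      have e21 : s''.reg 21 = j + 1 + 1 := by
        rw [hr 21 (by simp) (by simp)]
        simp [Instr.apply, h21, hcs.2]
      have e47 : s''.reg 47 = 2 ^ (j + 1) := by
        rw [hr 47 (by simp) (by simp)]
        simp [Instr.apply, h47, pow_succ, mul_two]
      refine ⟨⟨fun r hr => ?_, hf'.mem, hf'.asked⟩, ?_, ?_, ?_, ?_⟩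
      · rw [← hf'.reg r hr]
        simp only [List.mem_cons, List.not_mem_nil, or_false, not_or] at hr
        simp [Instr.apply, hr]
      · simp [Instr.apply, e21]
      · simp [Instr.apply, h46, hcs'.1, pow_succ]
      · simp [Instr.apply, e47]
      · simp [Instr.apply, e47, hf'.reg 0, hm]
  · rintro s' ⟨-, -, -, -, h48⟩
    rw [h48]
    exact (hcl _).2 le_rfl

/-- All points encoded by the numbers less than the number in cell `22` are queried. -/
def searchProg : Prog :=
  .seq (.instr (.const 23 1)) <| .seq (.instr (.const 24 16)) <|
  .seq (.loop 22 (.seq (.instr (.sub 22 22 11)) pointProg)) (.instr (.add 0 23 10))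

open Classical in
lemma searchProg_ends {s : State K n} (hs : Consts s) {b m Z U : ℕ} (hb0 : 0 < b)
    (h0 : s.reg 0 = n) (hb : s.reg 20 = b) (hm : s.reg 21 = m) (hZ : s.reg 22 = Z)
    (hbU : b ≤ U) (hZU : Z ≤ U) (hnU : n ≤ U) (hask : s.asked = ∅) :
    Ends E searchProg s (Z * (n * (m * (6 * U ^ 2 + 30 * U + 27) + 9) + 8) + 4) fun s' =>
      s'.asked = (fun z => fun i : Fin n => digitPoint E.sample b m z i) '' Set.Iio Z ∧
      s'.reg 0 = if ∀ z < Z, E.box (fun i : Fin n => digitPoint E.sample b m z i) = 0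
        then 1 else 0 := by
  set pt : ℕ → Fin n → K := fun z i => digitPoint E.sample b m z i with hpt
  -- Points are visited downwards, and a nonzero answer only clears the flag in cell `23`. As the
  -- search never stops early, the queried set does not depend on the answers.
  refine Ends.le (.step (.step (.seq (T := Z * (n * (m * (6 * U ^ 2 + 30 * U + 27) + 9) + 7 + 1) + 1)
    (T' := 1) (.countdown (fun j s' =>
    (∀ r, r ∉ 22 :: 24 :: pointCells → s'.reg r = s.reg r) ∧ s'.reg 24 = 16 ∧
    s'.asked = pt '' Set.Ico (Z - j) Z ∧
    s'.reg 23 = if ∀ z, Z - j ≤ z → z < Z → E.box (pt z) = 0 then 1 else 0)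
    Z (n * (m * (6 * U ^ 2 + 30 * U + 27) + 9) + 7) ?_ ?_ ?_) fun s' h => .instr ?_)))
    (le_of_eq (by ring))
  · simp [Instr.apply, hZ]
  · refine ⟨fun r hr => ?_, ?_, ?_, ?_⟩
    · simp only [pointCells, List.mem_cons, not_or] at hr
      simp [Instr.apply, hr]
    · simp [Instr.apply]
    · simp [Instr.apply, hask]
    · have : ∀ z, Z - 0 ≤ z → z < Z → E.box (pt z) = 0 := fun z h1 h2 => by omega
      rw [if_pos this]
      simp [Instr.apply]
  · rintro j hj s' ⟨hf, h24, hask', h23⟩ hcnt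
    have h11' : s'.reg 11 = 1 := (hf 11 (by simp [pointCells, levelCells])).trans hs.2
    have h10' : s'.reg 10 = 0 := (hf 10 (by simp [pointCells, levelCells])).trans hs.1
    have hrun := pointProg_ends (E := E) (s := Instr.apply E s' (.sub 22 22 11)) (b := b)
      (z := Z - (j + 1)) (m := m) (U := U) ⟨by simp [Instr.apply, h10'], by simp [Instr.apply, h11']⟩
      hb0 (by simp [Instr.apply, hf 0 (by simp [pointCells, levelCells]), h0])
      (by simp [Instr.apply, hf 20 (by simp [pointCells, levelCells]), hb])
      (by simp [Instr.apply, hf 21 (by simp [pointCells, levelCells]), hm])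
      (by simp [Instr.apply, hcnt, h11']; omega)
      (by simp [Instr.apply, h24]) hbU (by omega) hnU
    refine .step (.imp hrun fun s'' h => ?_)
    obtain ⟨hf'', hask'', h23''⟩ := h
    have hZj : Z - (j + 1) + 1 = Z - j := by omega
    refine ⟨⟨fun r hr => ?_, ?_, ?_, ?_⟩, ?_⟩
    · rw [← hf r hr]
      simp only [List.mem_cons, not_or] at hr
      rw [hf'' r hr.2.2]
      simp [Instr.apply, hr]
    · rw [hf'' 24 (by simp [pointCells, levelCells])]
      simp [Instr.apply, h24]
    · rw [hask'']
      simp only [Instr.apply, hask']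
      rw [← Set.image_insert_eq (f := pt) (a := Z - (j + 1))]
      congr 1
      ext z
      simp only [Set.mem_insert_iff, Set.mem_Ico]
      omega
    · rw [h23'']
      simp only [Instr.apply, Function.update_apply]
      simp only [show (23 : ℕ) ≠ 22 by norm_num, if_false, h23]
      rw [← ite_and]
      refine if_congr ⟨fun h z h1 h2 => ?_, fun h => ⟨h _ le_rfl (by omega), fun z h1 h2 =>
        h z (by omega) h2⟩⟩ rfl rfl
      rcases Nat.lt_or_ge z (Z - j) with h3 | h3
      · obtain rfl : z = Z - (j + 1) := by omega
        exact h.1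
      · exact h.2 z h3 h2
    · rw [hf'' 22 (by simp [pointCells, levelCells])]
      simp [Instr.apply, h11', hcnt]
      omega
  · obtain ⟨hf, -, hask', h23⟩ := h
    have h10' : s'.reg 10 = 0 := (hf 10 (by simp [pointCells, levelCells])).trans hs.1
    refine ⟨?_, ?_⟩
    · simp only [Instr.apply, hask', Nat.sub_self]
      congr 1
      ext z
      simp
    · simp [Instr.apply, h10', h23, hpt]

/-- The identity test. -/
def identityTest : Prog :=
  .seq (.instr (.const 11 1)) <| .seq sizeProg <| .seq baseProg <| .seq rangeProg searchProg

open Classical in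
lemma identityTest_ends {k w d : ℕ} (hn : 2 ≤ n) (hk : 1 ≤ k) (hw : 1 ≤ w) (hd : 1 ≤ d) (Z : ℕ)
    (hZ : Z = (sizeParam n k w d ^ 16) ^ (3 * (Nat.clog 2 n + 1))) :
    Ends E identityTest (init K n k w d) (Z ^ 13) fun s' =>
      s'.asked = (fun z => fun i : Fin n => digitPoint E.sample (sizeParam n k w d ^ 16)
        (Nat.clog 2 n + 1) z i) '' Set.Iio Z ∧
      s'.reg 0 = if ∀ z < Z, E.box (fun i : Fin n => digitPoint E.sample (sizeParam n k w d ^ 16)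
        (Nat.clog 2 n + 1) z i) = 0 then 1 else 0 := by
  set T := sizeParam n k w d with hTdef
  set L := Nat.clog 2 n with hLdef
  have hr : 1 ≤ w ^ (2 * k) := Nat.one_le_pow _ _ hw
  have hmkd : n * k * d ≤ T := Nat.le_mul_of_pos_right _ hr
  have hmk : n * k ≤ T := (Nat.le_mul_of_pos_right _ hd).trans hmkd
  have hnT : n ≤ T := (Nat.le_mul_of_pos_right _ hk).trans hmk
  have hkT : 2 * k ≤ T := (Nat.mul_le_mul_right k hn).trans hmk
  have hrT : w ^ (2 * k) ≤ T := Nat.le_mul_of_pos_left _ (by positivity)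
  have hT0 : 0 < T := by omega
  have hZ' : Z = ((T ^ 16) ^ 3) ^ (L + 1) := by rw [hZ, pow_mul]
  have hpow : ∀ i ≤ 48, T ^ i ≤ Z := fun i hi => by
    rw [hZ', ← pow_mul, ← pow_mul]
    exact Nat.pow_le_pow_right hT0 (by omega)
  have hTZ : T ≤ Z := by simpa using hpow 1 (by norm_num)
  have hLn : L + 1 ≤ n := by
    rw [Nat.succ_le_iff, hLdef]
    have h1 := Nat.pow_pred_clog_lt_self (b := 2) (by norm_num) (by omega : 1 < n)
    have h2 : 0 < Nat.clog 2 n := Nat.clog_pos (by norm_num) hn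
    have h3 : (Nat.clog 2 n).pred < 2 ^ (Nat.clog 2 n).pred := Nat.lt_two_pow_self
    rw [Nat.pred_eq_sub_one] at *
    omega
  have hZ2 : 2 ≤ Z := by omega
  -- Bounding all parameters by `Z` leaves a polynomial of degree `5` with coefficient sum `167 ≤ 2
  -- ^ 8 ≤ Z ^ 8`, hence the exponent `13`.
  have htime : (2 * k * (3 * Z + 6) + 9 * Z + 12) + ((18 * Z + 18) + ((L * (3 * Z + 8) + 5) +
      (Z * (n * ((L + 1) * (6 * Z ^ 2 + 30 * Z + 27) + 9) + 8) + 4))) + 1 ≤ Z ^ 13 := by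
    have h1 : 2 * k ≤ Z := hkT.trans hTZ
    have h2 : n ≤ Z := hnT.trans hTZ
    have h3 : L ≤ Z := by omega
    have h4 : L + 1 ≤ Z := by omega
    calc _ ≤ (Z * (3 * Z + 6) + 9 * Z + 12) + ((18 * Z + 18) + ((Z * (3 * Z + 8) + 5) +
          (Z * (Z * (Z * (6 * Z ^ 2 + 30 * Z + 27) + 9) + 8) + 4))) + 1 := by gcongr
      _ = 6 * Z ^ 5 + 30 * Z ^ 4 + 27 * Z ^ 3 + 15 * Z ^ 2 + 49 * Z + 40 := by ring
      _ ≤ 6 * Z ^ 5 + 30 * Z ^ 5 + 27 * Z ^ 5 + 15 * Z ^ 5 + 49 * Z ^ 5 + 40 * Z ^ 5 := by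
          have hp : ∀ i ≤ 5, Z ^ i ≤ Z ^ 5 := fun i hi => Nat.pow_le_pow_right (by omega) hi
          have e1 := hp 4 (by norm_num)
          have e2 := hp 3 (by norm_num)
          have e3 := hp 2 (by norm_num)
          have e4 := hp 1 (by norm_num)
          have e5 := hp 0 (by norm_num)
          rw [pow_one] at e4
          rw [pow_zero] at e5
          omega
      _ = 167 * Z ^ 5 := by ring
      _ ≤ 2 ^ 8 * Z ^ 5 := Nat.mul_le_mul_right _ (by norm_num)
      _ ≤ Z ^ 8 * Z ^ 5 := Nat.mul_le_mul_right _ (Nat.pow_le_pow_left hZ2 8)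
      _ = Z ^ 13 := by ring
  refine Ends.le (.step (.seq (sizeProg_ends (m := n) (k := k) (w := w) (d := d) (U := Z)
    ⟨by simp [Instr.apply, init], by simp [Instr.apply]⟩ (by simp [Instr.apply, init])
    (by simp [Instr.apply, init]) (by simp [Instr.apply, init]) (by simp [Instr.apply, init]) hw
    (hrT.trans hTZ) (hnT.trans hTZ) (hmk.trans hTZ) (hmkd.trans hTZ)) fun s₁ h₁ => ?_)) htime
  obtain ⟨hf1, h46⟩ := h₁
  have hcs : Consts (Instr.apply E (init K n k w d) (.const 11 1)) :=
    ⟨by simp [Instr.apply, init], by simp [Instr.apply]⟩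
  have hcs1 := hcs.frame hf1 (by simp) (by simp)
  refine .seq (baseProg_ends hcs1 h46 hT0 ((pow_mul T 16 2).ge.trans (hpow 32 (by norm_num))))
    fun s₂ h₂ => ?_
  obtain ⟨hf2, h20, h45⟩ := h₂
  have hF2 := hf1.trans hf2 (List.Subset.refl _) (List.Subset.refl _)
  have hcs2 := hcs.frame hF2 (by simp) (by simp)
  have h0 : s₂.reg 0 = n := by
    rw [hF2.reg 0 (by simp)]
    simp [Instr.apply, init]
  refine .seq (rangeProg_ends hcs2 h0 h45 (by positivity) hZ'.ge) fun s₃ h₃ => ?_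
  obtain ⟨hf3, h21, h22⟩ := h₃
  refine searchProg_ends (hcs2.frame hf3 (by simp) (by simp)) (by positivity)
    ((hf3.reg 0 (by simp)).trans h0) ((hf3.reg 20 (by simp)).trans h20) h21 (h22.trans hZ'.symm)
    (hpow 16 (by norm_num)) le_rfl (hnT.trans hTZ) ?_
  rw [hf3.asked, hF2.asked]
  rfl

end BlackBoxRAM

open BasisIsolation BlackBoxRAM

/-! ## Identity testing -/

lemma clog_add_one_le {n : ℕ} (hn : 2 ≤ n) : Nat.clog 2 n + 1 ≤ 3 * Nat.log 2 n := by
  have h1 : 1 ≤ Nat.log 2 n := Nat.log_pos (by norm_num) hn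
  have h2 : Nat.clog 2 n ≤ Nat.log 2 n + 1 :=
    Nat.clog_le_of_le_pow (Nat.lt_pow_succ_log_self (by norm_num) n).le
  omega

/-- Since `n ≥ 2`, the factor `k ≤ 2 ^ k` is absorbed by a `k`-th power even for `w = 1`. -/
lemma sizeParam_le_pow {n k w d : ℕ} (hn : 2 ≤ n) (hw : 1 ≤ w) (hd : 1 ≤ d) :
    sizeParam n k w d ≤ (n * d * w) ^ (4 * k) := by
  rcases Nat.eq_zero_or_pos k with rfl | hk
  · simp [sizeParam]
  set x := n * d * w
  have hnd : 1 ≤ n * d := Nat.mul_pos (by omega) hd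
  have hx : 2 ≤ x := by
    calc 2 = 2 * 1 * 1 := rfl
      _ ≤ n * d * w := by gcongr
  have h1 : n * d ≤ x ^ k := (Nat.le_mul_of_pos_right _ hw).trans (Nat.le_self_pow (by omega) x)
  have h2 : k ≤ x ^ k := Nat.lt_two_pow_self.le.trans (Nat.pow_le_pow_left hx k)
  have h3 : w ≤ x := Nat.le_mul_of_pos_left _ hnd
  calc sizeParam n k w d = n * d * k * w ^ (2 * k) := by rw [sizeParam]; ring
    _ ≤ x ^ k * x ^ k * x ^ (2 * k) := by gcongr
    _ = x ^ (4 * k) := by ring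

/-- Here `w ≥ 2` is essential: `k ≤ 2 ^ k ≤ w ^ k`, whereas for `w = 1` the right-hand side does not
grow with `k`. -/
lemma sizeParam_le_sq {n k w d : ℕ} (hn : 2 ≤ n) (hd : 1 ≤ d) (hw : 2 ≤ w) :
    sizeParam n k w d ≤ (n * w ^ (2 * k) * d) ^ 2 := by
  have h1 : k ≤ n * w ^ (2 * k) * d := by
    calc k ≤ 2 ^ k := Nat.lt_two_pow_self.le
      _ ≤ w ^ k := Nat.pow_le_pow_left hw k
      _ ≤ w ^ (2 * k) := Nat.pow_le_pow_right (by omega) (by omega)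
      _ = 1 * w ^ (2 * k) * 1 := by ring
      _ ≤ n * w ^ (2 * k) * d := by gcongr; omega
  calc sizeParam n k w d = n * w ^ (2 * k) * d * k := by rw [sizeParam]; ring
    _ ≤ n * w ^ (2 * k) * d * (n * w ^ (2 * k) * d) := Nat.mul_le_mul_left _ h1
    _ = _ := (sq _).symm

theorem mainTheorem5 :
    ∃ (C : ℕ) (P : BlackBoxRAM.Prog),
      ∀ (F : Type*) (K : Type*) [Field F] [Field K] [Algebra F K] (n k w d : ℕ),
        2 ≤ n → 1 ≤ k → 1 ≤ w → 1 ≤ d →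
        ∀ (N : ℕ) (α : Fin N → K), Function.Injective α →
          (n * k * d * w ^ (2 * k)) ^ C ≤ N →
          ∃ H : Finset (Fin n → K),
            IsHittingSet (kPassPolys F n k w d) H ∧
            H.card ≤ (n * d * w) ^ (C * k * Nat.log 2 n) ∧
            (2 ≤ w → H.card ≤ (n * w ^ (2 * k) * d) ^ (C * Nat.log 2 n)) ∧
            ∀ f ∈ kPassPolys F n k w d,
              ∃ (t : ℕ) (s : BlackBoxRAM.State K n),
                BlackBoxRAM.Exec (BlackBoxRAM.polyEnv α f) P
                  (BlackBoxRAM.init K n k w d) t s ∧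
                t ≤ (n * d * w) ^ (C * k * Nat.log 2 n) ∧
                (2 ≤ w → t ≤ (n * w ^ (2 * k) * d) ^ (C * Nat.log 2 n)) ∧
                s.asked = (H : Set (Fin n → K)) ∧
                (f = 0 → s.reg 0 = 1) ∧ (f ≠ 0 → s.reg 0 = 0) := by
  classical
  -- `7488 = 4 * 1872` and `1872 = 13 * 16 * 3 * 3`: time `Z ^ 13`, base `T ^ 16`, three digits per
  -- level, at most `3 * Nat.log 2 n` levels. The factor `4` comes from `sizeParam_le_pow`; for `w ≥
  -- 2` a factor `2` would do.
  refine ⟨7488, identityTest, ?_⟩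
  intro F K _ _ _ n k w d hn hk hw hd N α hα hN
  rw [← sizeParam] at hN
  have hT0 : 1 ≤ sizeParam n k w d := by
    have : 0 < n * k * d * w ^ (2 * k) := by positivity
    exact this
  set Z := (sizeParam n k w d ^ 16) ^ (3 * (Nat.clog 2 n + 1)) with hZdef
  have hZ0 : 1 ≤ Z := Nat.one_le_pow _ _ (Nat.one_le_pow _ _ hT0)
  have hZT : Z ^ 13 ≤ sizeParam n k w d ^ (1872 * Nat.log 2 n) := by
    rw [hZdef, ← pow_mul, ← pow_mul]
    refine Nat.pow_le_pow_right hT0 ?_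
    have := clog_add_one_le hn
    omega
  have hb1 : Z ^ 13 ≤ (n * d * w) ^ (7488 * k * Nat.log 2 n) := by
    refine hZT.trans ((Nat.pow_le_pow_left (sizeParam_le_pow hn hw hd) _).trans ?_)
    rw [← pow_mul]
    exact (congrArg _ (by ring)).le
  have hb2 : 2 ≤ w → Z ^ 13 ≤ (n * w ^ (2 * k) * d) ^ (7488 * Nat.log 2 n) := by
    intro hw2
    refine hZT.trans ((Nat.pow_le_pow_left (sizeParam_le_sq hn hd hw2) _).trans ?_)
    rw [← pow_mul]
    exact Nat.pow_le_pow_right (by positivity) (by omega)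
  let H : Finset (Fin n → K) := (Finset.range Z).image fun z => fun i : Fin n =>
    digitPoint (extendList α) (sizeParam n k w d ^ 16) (Nat.clog 2 n + 1) z i
  have hcard : H.card ≤ Z ^ 13 :=
    (Finset.card_image_le.trans (Finset.card_range Z).le).trans (Nat.le_self_pow (by norm_num) Z)
  have hhit : ∀ f ∈ kPassPolys F n k w d, f ≠ 0 → ∃ z < Z, MvPolynomial.aeval (fun i : Fin n =>
      digitPoint (extendList α) (sizeParam n k w d ^ 16) (Nat.clog 2 n + 1) z i) f ≠ 0 :=
    fun f hf hf0 => exists_digitPoint_ne_zero hn hk hw hd hα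
      ((Nat.pow_le_pow_right hT0 (by norm_num)).trans hN) hf hf0
  refine ⟨H, fun f hf hf0 => ?_, hcard.trans hb1, fun hw2 => hcard.trans (hb2 hw2),
    fun f hf => ?_⟩
  · obtain ⟨z, hz, hne⟩ := hhit f hf hf0
    exact ⟨_, Finset.mem_image_of_mem _ (Finset.mem_range.2 hz), hne⟩
  · obtain ⟨t, s, hexec, ht, hask, hres⟩ :=
      identityTest_ends (E := polyEnv α f) hn hk hw hd Z rfl
    refine ⟨t, s, hexec, ht.trans hb1, fun hw2 => ht.trans (hb2 hw2), ?_, ?_, ?_⟩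
    · rw [hask, Finset.coe_image, Finset.coe_range]
      rfl
    · rintro rfl
      rw [hres, if_pos]
      exact fun z _ => map_zero _
    · intro hf0
      obtain ⟨z, hz, hne⟩ := hhit f hf hf0
      rw [hres, if_neg]
      exact fun h => hne (h z hz)
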